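/- **Algorithm (BNQN New Variant).** Let $F:\mathbb R^m\to\mathbb R$ be twice continuously differentiable. The parameters are distinct real numbers $\delta_0,\dots,\delta_m$, and real numbers $\theta\ge 0$, $\tau>0$, $0<\gamma_0\le 1$; put $\kappa=\frac12\min_{i\ne j}|\delta_i-\delta_j|$. For a symmetric matrix $A$, let $\mathrm{minsp}(A)$ be the minimum of $|\lambda|$ over the eigenvalues $\lambda$ of $A$, and let $\mathrm{pr}_{A,\pm}$ be the orthogonal projection onto the span of the eigenvectors of $A$ with positive (respectively negative) eigenvalue. Given $z_k\in\mathbb R^m$, the next point $z_{k+1}$ is computed as follows. If $\nabla F(z_k)=0$, then $z_{k+1}=z_k$. Otherwise: * let $j$ be the first index in $0,\dots,m$ with $\mathrm{minsp}(\nabla^2F(z_k)+\delta_j\|\nabla F(z_k)\|^\tau \mathrm{Id})\ge\kappa\|\nabla F(z_k)\|^\tau$, and put $A_k=\nabla^2F(z_k)+\delta_j\|\nabla F(z_k)\|^\tau \mathrm{Id}$; * put $v_k=A_k^{-1}\nabla F(z_k)$, $w_k=\mathrm{pr}_{A_k,+}(v_k)-\mathrm{pr}_{A_k,-}(v_k)$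 and $\widehat w_k=w_k/\max\{1,\theta\|w_k\|\}$; * let $\gamma$ be the first number in the list $\gamma_0,\gamma_0/3,\gamma_0/3^2,\dots$ with $F(z_k-\gamma\widehat w_k)-F(z_k)\le-\gamma\langle\widehat w_k,\nabla F(z_k)\rangle/3$, and put $z_{k+1}=z_k-\gamma\widehat w_k$. **Theorem 1.** Let $g$ be a complex polynomial of degree $2$ and let $F:\mathbb R^2\to\mathbb R$, $F(x,y)=|g(x+iy)|^2/2$. Fix any admissible parameters $\delta_0,\delta_1,\delta_2,\theta,\tau,\gamma_0$ as above (with $m=2$), and identify $\mathbb R^2$ with $\mathbb C$ by $(x,y)\mapsto x+iy$. For every initial point $z_0\in\mathbb C$, BNQN New Variant applied to $F$ constructs a well-defined infinite sequence $\{z_n\}$ starting at $z_0$, and: 1. If $g(z)=c(z-z^*)^2$ with $c,z^*\in\mathbb C$, then for every $z_0\in\mathbb C$ the sequence $\{z_n\}$ converges to $z^*$. 2. Suppose that $g(z)=c(z-z_1^*)(z-z_2^*)$ with $c,z_1^*,z_2^*\in\mathbb C$ and $z_1^*\ne z_2^*$. Let $L$ be the perpendicular bisector of the segment from $z_1^*$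 to $z_2^*$, and let $H_1,H_2$ be the two open half-planes into which $L$ divides $\mathbb C$, with $z_1^*\in H_1$ and $z_2^*\in H_2$. a) If $z_0\in H_1$, then $\{z_n\}$ converges to $z_1^*$; if $z_0\in H_2$, then $\{z_n\}$ converges to $z_2^*$. b) If $z_0\in L$, then $\{z_n\}$ converges to $(z_1^*+z_2^*)/2$, which is the critical point of $g$, that is, $g'((z_1^*+z_2^*)/2)=0$. -/

import Mathlib

open Filter Topology Polynomial
open scoped Gradient

noncomputable section

/-- `½ · min_{i ≠ j} |δ i - δ j|`. -/
def bnqnKappa {N : ℕ} (δ : Fin N → ℝ) : ℝ :=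
  (1 / 2) * sInf {r : ℝ | ∃ i j : Fin N, i ≠ j ∧ r = |δ i - δ j|}

/-- `minsp A`: the minimum of `|μ|`, where `μ` runs over the (real) eigenvalues of `A`. -/
def minsp {m : ℕ} (A : Module.End ℝ (EuclideanSpace ℝ (Fin m))) : ℝ :=
  sInf {r : ℝ | ∃ μ : ℝ, A.HasEigenvalue μ ∧ r = |μ|}

/-- The span of the eigenvectors of `A` with positive eigenvalue. -/
def posSpace {m : ℕ} (A : Module.End ℝ (EuclideanSpace ℝ (Fin m))) :
    Submodule ℝ (EuclideanSpace ℝ (Fin m)) :=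
  ⨆ (μ : ℝ) (_ : 0 < μ), A.eigenspace μ

/-- The span of the eigenvectors of `A` with negative eigenvalue. -/
def negSpace {m : ℕ} (A : Module.End ℝ (EuclideanSpace ℝ (Fin m))) :
    Submodule ℝ (EuclideanSpace ℝ (Fin m)) :=
  ⨆ (μ : ℝ) (_ : μ < 0), A.eigenspace μ

/-- The perturbed Hessian `∇²F(z) + d ‖∇F(z)‖^τ Id`, as a linear operator. -/
def perturbedHessian {m : ℕ} (F : EuclideanSpace ℝ (Fin m) → ℝ) (τ d : ℝ)
    (z : EuclideanSpace ℝ (Fin m)) : Module.End ℝ (EuclideanSpace ℝ (Fin m)) :=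
  (fderiv ℝ (∇ F) z).toLinearMap + (d * ‖∇ F z‖ ^ τ) • LinearMap.id

/-- `w = pr_{A,+}(v) - pr_{A,-}(v)` with `v = A⁻¹ b`.  (For `b = 0` this is `0`, whether or not `A`
is invertible.) -/
def newtonDirection {m : ℕ} (A : Module.End ℝ (EuclideanSpace ℝ (Fin m)))
    (b : EuclideanSpace ℝ (Fin m)) : EuclideanSpace ℝ (Fin m) :=
  (posSpace A).starProjection (Ring.inverse A b) - (negSpace A).starProjection (Ring.inverse A b)

/-- `ŵ = w / max {1, θ ‖w‖}`. -/
def truncateDirection {m : ℕ} (θ : ℝ) (w : EuclideanSpace ℝ (Fin m)) :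
    EuclideanSpace ℝ (Fin m) :=
  (max 1 (θ * ‖w‖))⁻¹ • w

/-- The first while loop of BNQN New Variant, at the point `z`, stops at the index `j`
(it is not entered when the gradient vanishes). -/
def IsDeltaIndex {m : ℕ} (F : EuclideanSpace ℝ (Fin m) → ℝ) (δ : Fin (m + 1) → ℝ) (τ : ℝ)
    (z : EuclideanSpace ℝ (Fin m)) (j : Fin (m + 1)) : Prop :=
  (∇ F z ≠ 0 →
    IsLeast {i : Fin (m + 1) |
      bnqnKappa δ * ‖∇ F z‖ ^ τ ≤ minsp (perturbedHessian F τ (δ i) z)} j) ∧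
  (∇ F z = 0 → j = 0)

/-- The second while loop (Armijo backtracking with direction `u`) of BNQN New Variant, at the
point `z`, stops after `l` divisions of `γ₀` by `3` (it is not entered when the gradient
vanishes). -/
def IsBacktrackCount {m : ℕ} (F : EuclideanSpace ℝ (Fin m) → ℝ) (γ₀ : ℝ)
    (z u : EuclideanSpace ℝ (Fin m)) (l : ℕ) : Prop :=
  (∇ F z ≠ 0 →
    IsLeast {k : ℕ |
      F (z - (γ₀ / 3 ^ k) • u) - F z ≤ -((γ₀ / 3 ^ k) * inner ℝ u (∇ F z)) / 3} l) ∧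
  (∇ F z = 0 → l = 0)

/-- One iteration of BNQN New Variant for the cost function `F`, with parameters
`δ₀, …, δₘ, θ, τ, γ₀`: both while loops stop when started at the point `z`, and the next point
is `z'`. -/
def IsBNQNStep {m : ℕ} (F : EuclideanSpace ℝ (Fin m) → ℝ) (δ : Fin (m + 1) → ℝ) (θ τ γ₀ : ℝ)
    (z z' : EuclideanSpace ℝ (Fin m)) : Prop :=
  ∃ (j : Fin (m + 1)) (u : EuclideanSpace ℝ (Fin m)) (l : ℕ),
    IsDeltaIndex F δ τ z j ∧
    u = truncateDirection θ (newtonDirection (perturbedHessian F τ (δ j) z) (∇ F z)) ∧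
    IsBacktrackCount F γ₀ z u l ∧
    z' = z - (γ₀ / 3 ^ l) • u

/-- `z` is the sequence constructed by BNQN New Variant for the cost function `F`, with parameters
`δ₀, …, δₘ, θ, τ, γ₀`, from the initial point `z₀`. -/
def IsBNQNSequence {m : ℕ} (F : EuclideanSpace ℝ (Fin m) → ℝ) (δ : Fin (m + 1) → ℝ) (θ τ γ₀ : ℝ)
    (z₀ : EuclideanSpace ℝ (Fin m)) (z : ℕ → EuclideanSpace ℝ (Fin m)) : Prop :=
  z 0 = z₀ ∧ ∀ n : ℕ, IsBNQNStep F δ θ τ γ₀ (z n) (z (n + 1))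

/-- The identification `(x, y) ↦ x + iy` of `ℝ²` with `ℂ`. -/
def toComplex (p : EuclideanSpace ℝ (Fin 2)) : ℂ :=
  (p 0 : ℂ) + (p 1 : ℂ) * Complex.I

/-- The cost function `F(x, y) = |g(x + iy)|² / 2`. -/
def costFunction (g : ℂ[X]) (p : EuclideanSpace ℝ (Fin 2)) : ℝ :=
  ‖g.eval (toComplex p)‖ ^ 2 / 2

end

noncomputable section

open scoped ComplexConjugate

/-! ### The Newton direction on eigenvectors. -/

section LinearAlgebra

variable {m : ℕ}

/-! Completing the square gives g(ζ) = c((ζ-m)² - a²). With u = z - m, K = |c| and q = u² - a², the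
cost is K²|q|²/2 and its gradient is 2K²q·conj u. The Hessian is h ↦ 4K²|u|²h + 2K²q·conj h, whose
eigenvalues 2K²(2|u|² ± |q|) and eigencomponents of the gradient are explicit. One step of the
algorithm thus becomes a formula in ℂ (`IsReducedStep`).

The decisive fact is that the component along a, Re(conj a · u), is merely multiplied by a real
factor 1 - (step)·`quadSlope` (`IsReducedStep.re_eq`). Hence the bisector Re(conj a · u) = 0 is
invariant. The Armijo inequality and nonnegativity of the cost make the factor positive
(`IsReducedStep.slope_lt`), so each open half-plane is invariant too.

Orbits are bounded and the cost decreases by a definite amount wherever the gradient is bounded away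
from 0 (`exists_uniform_decrease`), so |q||u| → 0. For a = 0 this says |u|³ → 0. On the bisector |q|
≥ |a|², so u → 0. In the half-plane of a, |q| converges because the cost does. If its limit is 0,
then |u + a| ≥ |a| forces u → a. Otherwise u → 0; but near 0 the slope is nonpositive, so the
positive quantity Re(conj a · u) would eventually be nondecreasing, which is impossible
(`IsReducedOrbit.not_tendsto_zero`). The other half-plane follows by exchanging the roots. -/

theorem newtonDirection_add (A : Module.End ℝ (EuclideanSpace ℝ (Fin m)))
    (b b' : EuclideanSpace ℝ (Fin m)) :
    newtonDirection A (b + b') = newtonDirection A b + newtonDirection A b' := by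
  simp only [newtonDirection, map_add]
  abel

theorem eigenspace_le_posSpace {A : Module.End ℝ (EuclideanSpace ℝ (Fin m))} {μ : ℝ}
    (hμ : 0 < μ) : A.eigenspace μ ≤ posSpace A :=
  le_iSup₂_of_le μ hμ le_rfl

theorem eigenspace_le_negSpace {A : Module.End ℝ (EuclideanSpace ℝ (Fin m))} {μ : ℝ}
    (hμ : μ < 0) : A.eigenspace μ ≤ negSpace A :=
  le_iSup₂_of_le μ hμ le_rfl

theorem eigenspace_isOrtho {A : Module.End ℝ (EuclideanSpace ℝ (Fin m))} (hA : A.IsSymmetric)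
    {μ ν : ℝ} (h : μ ≠ ν) : A.eigenspace μ ⟂ A.eigenspace ν := by
  have := hA.orthogonalFamily_eigenspaces
  exact this.isOrtho h

theorem eigenspace_isOrtho_negSpace {A : Module.End ℝ (EuclideanSpace ℝ (Fin m))}
    (hA : A.IsSymmetric) {μ : ℝ} (hμ : 0 < μ) : A.eigenspace μ ⟂ negSpace A := by
  simp only [negSpace, Submodule.isOrtho_iSup_right]
  intro ν hν
  exact eigenspace_isOrtho hA (by linarith)

theorem eigenspace_isOrtho_posSpace {A : Module.End ℝ (EuclideanSpace ℝ (Fin m))}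
    (hA : A.IsSymmetric) {μ : ℝ} (hμ : μ < 0) : A.eigenspace μ ⟂ posSpace A := by
  simp only [posSpace, Submodule.isOrtho_iSup_right]
  intro ν hν
  exact eigenspace_isOrtho hA (by linarith)

/-- Inversion divides by μ, and the sign change on the negative eigenspaces turns this into division
by |μ|. Orthogonality of eigenspaces makes the projection of the opposite sign vanish. -/
theorem newtonDirection_of_mem_eigenspace {A : Module.End ℝ (EuclideanSpace ℝ (Fin m))}
    (hA : A.IsSymmetric) (hu : IsUnit A) {μ : ℝ} (hμ : μ ≠ 0)
    {b : EuclideanSpace ℝ (Fin m)} (hb : A b = μ • b) :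
    newtonDirection A b = |μ|⁻¹ • b := by
  have hinv : Ring.inverse A b = μ⁻¹ • b := by
    have h1 : (Ring.inverse A * A) b = b := by rw [Ring.inverse_mul_cancel _ hu]; rfl
    rw [Module.End.mul_apply, hb, map_smul] at h1
    rw [← h1, smul_smul, h1, inv_mul_cancel₀ hμ, one_smul]
  have hmem : b ∈ A.eigenspace μ := Module.End.mem_eigenspace_iff.2 hb
  rw [newtonDirection, hinv, map_smul, map_smul]
  rcases lt_or_gt_of_ne hμ with h | h
  · rw [Submodule.starProjection_eq_self_iff.2 (eigenspace_le_negSpace h hmem),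
      (Submodule.starProjection_apply_eq_zero_iff _).2
        ((eigenspace_isOrtho_posSpace hA h).le hmem), abs_of_neg h]
    simp [inv_neg]
  · rw [Submodule.starProjection_eq_self_iff.2 (eigenspace_le_posSpace h hmem),
      (Submodule.starProjection_apply_eq_zero_iff _).2
        ((eigenspace_isOrtho_negSpace hA h).le hmem), abs_of_pos h]
    simp

end LinearAlgebra

/-! ### Separation of the shifts. -/

section Kappa

variable {N : ℕ} {δ : Fin N → ℝ}

theorem finite_setOf_abs_sub (δ : Fin N → ℝ) :
    {r : ℝ | ∃ i j : Fin N, i ≠ j ∧ r = |δ i - δ j|}.Finite := by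
  refine (Set.finite_range fun p : Fin N × Fin N => |δ p.1 - δ p.2|).subset ?_
  rintro r ⟨i, j, -, rfl⟩
  exact ⟨(i, j), rfl⟩

theorem two_mul_bnqnKappa_le {i j : Fin N} (h : i ≠ j) :
    2 * bnqnKappa δ ≤ |δ i - δ j| := by
  have := csInf_le (finite_setOf_abs_sub δ).bddBelow ⟨i, j, h, rfl⟩
  rw [bnqnKappa]
  linarith

theorem bnqnKappa_pos (hδ : Function.Injective δ) {i j : Fin N} (h : i ≠ j) :
    0 < bnqnKappa δ := by
  have hne : {r : ℝ | ∃ i j : Fin N, i ≠ j ∧ r = |δ i - δ j|}.Nonempty := ⟨_, i, j, h, rfl⟩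
  obtain ⟨i', j', h', e⟩ := hne.csInf_mem (finite_setOf_abs_sub δ)
  rw [bnqnKappa, e]
  have := abs_pos.2 (sub_ne_zero.2 (hδ.ne h'))
  positivity

/-- Two real numbers can exclude at most two of three separated shifts. -/
theorem exists_shift {δ : Fin 3 → ℝ} {n : ℝ} (hn : 0 < n) (x y : ℝ) :
    ∃ j, bnqnKappa δ * n ≤ |x + δ j * n| ∧ bnqnKappa δ * n ≤ |y + δ j * n| := by
  by_contra! H
  -- One number excludes at most one shift, since the shifts are at least 2κn apart. Three shifts
  -- and two numbers then give a contradiction by pigeonhole.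
  have key : ∀ (x : ℝ) (i j : Fin 3), i ≠ j → |x + δ i * n| < bnqnKappa δ * n →
      |x + δ j * n| < bnqnKappa δ * n → False := by
    intro x i j hij hi hj
    have h1 := two_mul_bnqnKappa_le (δ := δ) hij
    have h2 : |δ i - δ j| * n = |(x + δ i * n) - (x + δ j * n)| := by
      rw [← abs_of_pos hn, ← abs_mul, abs_of_pos hn]; congr 1; ring
    have h3 := abs_sub (x + δ i * n) (x + δ j * n)
    nlinarith
  have H' : ∀ j, |x + δ j * n| < bnqnKappa δ * n ∨ |y + δ j * n| < bnqnKappa δ * n := by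
    intro j
    by_cases h : |x + δ j * n| < bnqnKappa δ * n
    · exact Or.inl h
    · exact Or.inr (H j (not_lt.1 h))
  have d1 : (0 : Fin 3) ≠ 1 := by decide
  have d2 : (0 : Fin 3) ≠ 2 := by decide
  have d3 : (1 : Fin 3) ≠ 2 := by decide
  rcases H' 0 with h0 | h0 <;> rcases H' 1 with h1 | h1 <;> rcases H' 2 with h2 | h2 <;>
    first
      | exact key _ _ _ d1 h0 h1
      | exact key _ _ _ d2 h0 h2
      | exact key _ _ _ d3 h1 h2

end Kappa

/-! ### Gradient and Hessian of the cost in complex notation. -/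

section Calculus

/-- The identification of the Euclidean plane with `ℂ`, as a linear isometry. -/
def planeIsometry : EuclideanSpace ℝ (Fin 2) ≃ₗᵢ[ℝ] ℂ := Complex.orthonormalBasisOneI.repr.symm

theorem planeIsometry_apply (p : EuclideanSpace ℝ (Fin 2)) : planeIsometry p = toComplex p := by
  have : planeIsometry p = ∑ i, p i • Complex.orthonormalBasisOneI i := by
    rw [planeIsometry]
    exact (OrthonormalBasis.sum_repr_symm _ _).symm
  rw [this]
  simp [toComplex, Fin.sum_univ_two]

/-- `K²|u² - a²|²/2`. -/
def quadCost (K : ℝ) (a u : ℂ) : ℝ := K ^ 2 * ‖u ^ 2 - a ^ 2‖ ^ 2 / 2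

/-- The gradient of `quadCost K a`. -/
def quadGrad (K : ℝ) (a u : ℂ) : ℂ := 2 * (K : ℂ) ^ 2 * ((u ^ 2 - a ^ 2) * conj u)

variable {c m a : ℂ} {g : ℂ[X]}

theorem costFunction_eq (hg : ∀ ζ, g.eval ζ = c * ((ζ - m) ^ 2 - a ^ 2))
    (p : EuclideanSpace ℝ (Fin 2)) :
    costFunction g p = quadCost ‖c‖ a (planeIsometry p - m) := by
  rw [costFunction, hg, quadCost, planeIsometry_apply, norm_mul, mul_pow]

theorem hasGradientAt_costFunction (hg : ∀ ζ, g.eval ζ = c * ((ζ - m) ^ 2 - a ^ 2))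
    (p : EuclideanSpace ℝ (Fin 2)) :
    HasGradientAt (costFunction g)
      (planeIsometry.symm (quadGrad ‖c‖ a (planeIsometry p - m))) p := by
  rw [hasGradientAt_iff_hasFDerivAt]
  have hT : HasFDerivAt (fun p => planeIsometry p)
      (planeIsometry.toContinuousLinearEquiv : EuclideanSpace ℝ (Fin 2) →L[ℝ] ℂ) p :=
    planeIsometry.toContinuousLinearEquiv.hasFDerivAt
  have hq : HasFDerivAt (fun p => (planeIsometry p - m) ^ 2 - a ^ 2) _ p :=
    ((hT.sub_const m).pow 2).sub_const (a ^ 2)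
  have hF : HasFDerivAt (costFunction g) _ p :=
    (((hq.norm_sq).const_mul (‖c‖ ^ 2 / 2))).congr_of_eventuallyEq
      (Eventually.of_forall fun p => by
        rw [costFunction_eq hg, quadCost]; ring)
  refine hF.congr_fderiv ?_
  ext h
  simp only [InnerProductSpace.toDual_apply_apply]
  rw [← planeIsometry.inner_map_map, LinearIsometryEquiv.apply_symm_apply]
  simp [quadGrad, Complex.inner, Complex.mul_re, Complex.mul_im, pow_two]
  ring

theorem gradient_costFunction (hg : ∀ ζ, g.eval ζ = c * ((ζ - m) ^ 2 - a ^ 2)) :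
    ∇ (costFunction g) = fun p =>
      planeIsometry.symm (quadGrad ‖c‖ a (planeIsometry p - m)) :=
  funext fun p => (hasGradientAt_costFunction hg p).gradient

theorem fderiv_gradient_costFunction (hg : ∀ ζ, g.eval ζ = c * ((ζ - m) ^ 2 - a ^ 2))
    (p h : EuclideanSpace ℝ (Fin 2)) :
    planeIsometry (fderiv ℝ (∇ (costFunction g)) p h) =
      (4 * ‖c‖ ^ 2 * ‖planeIsometry p - m‖ ^ 2 : ℝ) * planeIsometry h +
        2 * (‖c‖ : ℂ) ^ 2 * (((planeIsometry p - m) ^ 2 - a ^ 2) * conj (planeIsometry h)) := by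
  rw [gradient_costFunction hg]
  have hT : HasFDerivAt (fun p => planeIsometry p)
      (planeIsometry.toContinuousLinearEquiv : EuclideanSpace ℝ (Fin 2) →L[ℝ] ℂ) p :=
    planeIsometry.toContinuousLinearEquiv.hasFDerivAt
  have hq : HasFDerivAt (fun p => (planeIsometry p - m) ^ 2 - a ^ 2) _ p :=
    ((hT.sub_const m).pow 2).sub_const (a ^ 2)
  have hc : HasFDerivAt (fun p => conj (planeIsometry p - m)) _ p :=
    (Complex.conjCLE.hasFDerivAt (x := planeIsometry p - m)).comp p (hT.sub_const m)
  have hG := (planeIsometry.symm.toContinuousLinearEquiv.hasFDerivAt).comp p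
    ((hq.mul hc).const_mul (2 * (‖c‖ : ℂ) ^ 2))
  have hG' : HasFDerivAt (fun p =>
      planeIsometry.symm (quadGrad ‖c‖ a (planeIsometry p - m))) _ p := hG
  rw [hG'.fderiv]
  simp
  rw [← Complex.ofReal_pow ‖planeIsometry p - m‖, ← Complex.normSq_eq_norm_sq,
    Complex.normSq_eq_conj_mul_self]
  simp
  ring

end Calculus

/-! ### Spectral theory of h ↦ xh + β·conj h. -/

section ConjOperator

variable {A : Module.End ℝ (EuclideanSpace ℝ (Fin 2))} {x : ℝ} {β : ℂ}

theorem isSymmetric_of_conj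
    (hA : ∀ h, planeIsometry (A h) = x * planeIsometry h + β * conj (planeIsometry h)) :
    A.IsSymmetric := by
  intro h k
  rw [← planeIsometry.inner_map_map, ← planeIsometry.inner_map_map, hA, hA]
  simp [Complex.inner, Complex.mul_re, Complex.mul_im]
  ring

theorem apply_eq_smul_of_conj
    (hA : ∀ h, planeIsometry (A h) = x * planeIsometry h + β * conj (planeIsometry h))
    {ν : ℝ} {e : ℂ} (he : β * conj e = ν * e) :
    A (planeIsometry.symm e) = (x + ν) • planeIsometry.symm e := by
  apply planeIsometry.injective
  rw [hA, map_smul, LinearIsometryEquiv.apply_symm_apply, he, Complex.real_smul]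
  push_cast
  ring

theorem hasEigenvalue_of_conj
    (hA : ∀ h, planeIsometry (A h) = x * planeIsometry h + β * conj (planeIsometry h))
    {ν : ℝ} {e : ℂ} (h0 : e ≠ 0) (he : β * conj e = ν * e) : A.HasEigenvalue (x + ν) :=
  Module.End.hasEigenvalue_of_hasEigenvector (x := planeIsometry.symm e)
    ⟨Module.End.mem_eigenspace_iff.2 (apply_eq_smul_of_conj hA he), by simpa using h0⟩

theorem hasEigenvalue_iff_of_conj
    (hA : ∀ h, planeIsometry (A h) = x * planeIsometry h + β * conj (planeIsometry h))
    (hβ : β ≠ 0) (μ : ℝ) : A.HasEigenvalue μ ↔ μ = x + ‖β‖ ∨ μ = x - ‖β‖ := by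
  constructor
  · intro h
    obtain ⟨v, hv⟩ := h.exists_hasEigenvector
    have h1 := congrArg planeIsometry hv.apply_eq_smul
    rw [hA, map_smul, Complex.real_smul] at h1
    have h0 : planeIsometry v ≠ 0 := by simpa using hv.2
    have h2 : β * conj (planeIsometry v) = ((μ - x : ℝ) : ℂ) * planeIsometry v := by
      push_cast; linear_combination h1
    have h3 := congrArg norm h2
    rw [norm_mul, norm_mul, RCLike.norm_conj, Complex.norm_real] at h3
    have h4 := mul_right_cancel₀ (norm_ne_zero_iff.2 h0) h3
    rw [Real.norm_eq_abs] at h4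
    rcases abs_cases (μ - x) with h | h
    · left; linarith
    · right; linarith
  -- If e² = β then β·conj e = |β|e, and multiplying e by i changes the sign: this gives both
  -- eigenvectors.
  · obtain ⟨e, he⟩ := IsAlgClosed.exists_pow_nat_eq β (n := 2) (by norm_num)
    have he0 : e ≠ 0 := by rintro rfl; simp at he; exact hβ he.symm
    have hn : ((‖β‖ : ℝ) : ℂ) = e * conj e := by
      rw [← he, norm_pow, ← Complex.normSq_eq_norm_sq, ← Complex.mul_conj]
    rintro (rfl | rfl)
    · exact hasEigenvalue_of_conj hA he0 (by rw [hn, ← he]; ring)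
    · rw [sub_eq_add_neg]
      refine hasEigenvalue_of_conj hA (e := Complex.I * e) (by simp [he0]) ?_
      push_cast
      rw [hn, ← he, map_mul, Complex.conj_I]
      ring

theorem minsp_of_conj
    (hA : ∀ h, planeIsometry (A h) = x * planeIsometry h + β * conj (planeIsometry h))
    (hβ : β ≠ 0) : minsp A = min |x + ‖β‖| |x - ‖β‖| := by
  have : {r : ℝ | ∃ μ : ℝ, A.HasEigenvalue μ ∧ r = |μ|} = {|x + ‖β‖|, |x - ‖β‖|} := by
    ext r
    simp only [hasEigenvalue_iff_of_conj hA hβ, Set.mem_ofPred_eq, Set.mem_insert_iff,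
      Set.mem_singleton_iff]
    constructor
    · rintro ⟨μ, rfl | rfl, rfl⟩ <;> simp
    · rintro (rfl | rfl)
      · exact ⟨_, Or.inl rfl, rfl⟩
      · exact ⟨_, Or.inr rfl, rfl⟩
  rw [minsp, this, csInf_pair]

theorem isUnit_of_conj
    (hA : ∀ h, planeIsometry (A h) = x * planeIsometry h + β * conj (planeIsometry h))
    (hβ : β ≠ 0) (h₁ : x + ‖β‖ ≠ 0) (h₂ : x - ‖β‖ ≠ 0) : IsUnit A := by
  rw [LinearMap.isUnit_iff_ker_eq_bot, ← Module.End.eigenspace_zero]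
  by_contra h
  rcases (hasEigenvalue_iff_of_conj hA hβ 0).1 h with h | h
  · exact h₁ h.symm
  · exact h₂ h.symm

theorem newtonDirection_of_conj
    (hA : ∀ h, planeIsometry (A h) = x * planeIsometry h + β * conj (planeIsometry h))
    (hβ : β ≠ 0) (h₁ : x + ‖β‖ ≠ 0) (h₂ : x - ‖β‖ ≠ 0) {e f : ℂ}
    (he : β * conj e = ‖β‖ * e) (hf : β * conj f = -‖β‖ * f) :
    newtonDirection A (planeIsometry.symm (e + f)) =
      planeIsometry.symm (|x + ‖β‖|⁻¹ • e + |x - ‖β‖|⁻¹ • f) := by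
  have hu := isUnit_of_conj hA hβ h₁ h₂
  have hs := isSymmetric_of_conj hA
  rw [map_add, newtonDirection_add,
    newtonDirection_of_mem_eigenspace hs hu h₁ (apply_eq_smul_of_conj hA he),
    newtonDirection_of_mem_eigenspace hs hu h₂
      (apply_eq_smul_of_conj (ν := -‖β‖) hA (by push_cast; exact hf)),
    map_add, map_smul, map_smul, sub_eq_add_neg]

end ConjOperator

/-! ### The algorithm's step as a formula in the complex plane. -/

section ReducedStep

/-- The larger eigenvalue of the Hessian of `quadCost K a`. -/
def quadEigMax (K : ℝ) (a u : ℂ) : ℝ := 2 * K ^ 2 * (2 * ‖u‖ ^ 2 + ‖u ^ 2 - a ^ 2‖)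

/-- The smaller eigenvalue of the Hessian of `quadCost K a`. -/
def quadEigMin (K : ℝ) (a u : ℂ) : ℝ := 2 * K ^ 2 * (2 * ‖u‖ ^ 2 - ‖u ^ 2 - a ^ 2‖)

/-- The component of the gradient in the eigenspace of `quadEigMax`. -/
def quadGradMax (K : ℝ) (a u : ℂ) : ℂ :=
  (K : ℂ) ^ 2 * ((u ^ 2 - a ^ 2) * conj u + ‖u ^ 2 - a ^ 2‖ * u)

/-- The component of the gradient in the eigenspace of `quadEigMin`. -/
def quadGradMin (K : ℝ) (a u : ℂ) : ℂ :=
  (K : ℂ) ^ 2 * ((u ^ 2 - a ^ 2) * conj u - ‖u ^ 2 - a ^ 2‖ * u)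

/-- The Newton direction for `quadCost K a` when the Hessian is shifted by `s`. -/
def quadDir (K : ℝ) (a u : ℂ) (s : ℝ) : ℂ :=
  |quadEigMax K a u + s|⁻¹ • quadGradMax K a u + |quadEigMin K a u + s|⁻¹ • quadGradMin K a u

theorem quadGrad_eq_add (K : ℝ) (a u : ℂ) :
    quadGrad K a u = quadGradMax K a u + quadGradMin K a u := by
  rw [quadGrad, quadGradMax, quadGradMin]; ring

/-- The truncated Newton direction. -/
def quadTrunc (K : ℝ) (a u : ℂ) (θ s : ℝ) : ℂ :=
  (max 1 (θ * ‖quadDir K a u s‖))⁻¹ • quadDir K a u s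

/-- The shift `s` keeps the Hessian away from singular matrices. -/
def IsGoodShift (K : ℝ) (a u : ℂ) (κ τ s : ℝ) : Prop :=
  κ * ‖quadGrad K a u‖ ^ τ ≤ |quadEigMax K a u + s| ∧
    κ * ‖quadGrad K a u‖ ^ τ ≤ |quadEigMin K a u + s|

/-- The Armijo condition for `quadCost K a` at `u`, for the displacement `-d`. -/
def QuadArmijo (K : ℝ) (a u d : ℂ) : Prop :=
  quadCost K a (u - d) - quadCost K a u ≤ -inner ℝ d (quadGrad K a u) / 3

variable {c m a : ℂ} {g : ℂ[X]}

theorem norm_gradient_costFunction (hg : ∀ ζ, g.eval ζ = c * ((ζ - m) ^ 2 - a ^ 2))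
    (p : EuclideanSpace ℝ (Fin 2)) :
    ‖∇ (costFunction g) p‖ = ‖quadGrad ‖c‖ a (planeIsometry p - m)‖ := by
  rw [gradient_costFunction hg, LinearIsometryEquiv.norm_map]

theorem perturbedHessian_costFunction (hg : ∀ ζ, g.eval ζ = c * ((ζ - m) ^ 2 - a ^ 2))
    (τ d : ℝ) (p h : EuclideanSpace ℝ (Fin 2)) :
    planeIsometry (perturbedHessian (costFunction g) τ d p h) =
      (4 * ‖c‖ ^ 2 * ‖planeIsometry p - m‖ ^ 2 +
        d * ‖quadGrad ‖c‖ a (planeIsometry p - m)‖ ^ τ : ℝ) * planeIsometry h +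
        2 * (‖c‖ : ℂ) ^ 2 * ((planeIsometry p - m) ^ 2 - a ^ 2) * conj (planeIsometry h) := by
  have h1 := fderiv_gradient_costFunction hg p h
  rw [perturbedHessian, LinearMap.add_apply, map_add, LinearMap.smul_apply, map_smul,
    norm_gradient_costFunction hg]
  simp only [ContinuousLinearMap.coe_coe, LinearMap.id_apply, h1, Complex.real_smul]
  push_cast
  ring

theorem norm_two_mul_sq_mul (K : ℝ) (q : ℂ) : ‖2 * (K : ℂ) ^ 2 * q‖ = 2 * K ^ 2 * ‖q‖ := by
  simp

theorem sub_ne_zero_of_quadGrad {K : ℝ} {a u : ℂ} (h : quadGrad K a u ≠ 0) :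
    K ≠ 0 ∧ u ^ 2 - a ^ 2 ≠ 0 ∧ u ≠ 0 := by
  refine ⟨?_, ?_, ?_⟩ <;> intro h0 <;> apply h <;> simp [quadGrad, h0]

theorem minsp_perturbedHessian (hg : ∀ ζ, g.eval ζ = c * ((ζ - m) ^ 2 - a ^ 2))
    (τ d : ℝ) (p : EuclideanSpace ℝ (Fin 2))
    (h0 : quadGrad ‖c‖ a (planeIsometry p - m) ≠ 0) :
    minsp (perturbedHessian (costFunction g) τ d p) =
      min |quadEigMax ‖c‖ a (planeIsometry p - m) +
          d * ‖quadGrad ‖c‖ a (planeIsometry p - m)‖ ^ τ|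
        |quadEigMin ‖c‖ a (planeIsometry p - m) +
          d * ‖quadGrad ‖c‖ a (planeIsometry p - m)‖ ^ τ| := by
  obtain ⟨hK, hq, -⟩ := sub_ne_zero_of_quadGrad h0
  rw [minsp_of_conj (perturbedHessian_costFunction hg τ d p)
    (mul_ne_zero (by simpa using hK) hq), norm_two_mul_sq_mul, quadEigMax, quadEigMin]
  congr 2 <;> ring

/-- With q = u² - a² ≠ 0, the involution h ↦ (q/|q|)·conj h exchanges q·conj u and |q|u. Their sum
and difference are therefore its ±1 eigenvectors, which is where the two gradient components come
from. -/
theorem mul_conj_quadGradMax (K : ℝ) (a u : ℂ) :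
    2 * (K : ℂ) ^ 2 * (u ^ 2 - a ^ 2) * conj (quadGradMax K a u) =
      ((2 * K ^ 2 * ‖u ^ 2 - a ^ 2‖ : ℝ) : ℂ) * quadGradMax K a u := by
  have hn : ((‖u ^ 2 - a ^ 2‖ : ℝ) : ℂ) ^ 2 = (u ^ 2 - a ^ 2) * conj (u ^ 2 - a ^ 2) := by
    rw [← Complex.ofReal_pow, ← Complex.normSq_eq_norm_sq, ← Complex.mul_conj]
  rw [quadGradMax]
  push_cast
  simp only [map_mul, map_add, map_pow, Complex.conj_ofReal, Complex.conj_conj]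
  rw [map_sub, map_pow, map_pow] at hn ⊢
  linear_combination (-2) * (K : ℂ) ^ 4 * u * hn

theorem mul_conj_quadGradMin (K : ℝ) (a u : ℂ) :
    2 * (K : ℂ) ^ 2 * (u ^ 2 - a ^ 2) * conj (quadGradMin K a u) =
      -((2 * K ^ 2 * ‖u ^ 2 - a ^ 2‖ : ℝ) : ℂ) * quadGradMin K a u := by
  have hn : ((‖u ^ 2 - a ^ 2‖ : ℝ) : ℂ) ^ 2 = (u ^ 2 - a ^ 2) * conj (u ^ 2 - a ^ 2) := by
    rw [← Complex.ofReal_pow, ← Complex.normSq_eq_norm_sq, ← Complex.mul_conj]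
  rw [quadGradMin]
  push_cast
  simp only [map_mul, map_sub, map_pow, Complex.conj_ofReal, Complex.conj_conj] at hn ⊢
  linear_combination (-2) * (K : ℂ) ^ 4 * u * hn

theorem newtonDirection_costFunction (hg : ∀ ζ, g.eval ζ = c * ((ζ - m) ^ 2 - a ^ 2))
    (τ d : ℝ) (p : EuclideanSpace ℝ (Fin 2))
    (h0 : quadGrad ‖c‖ a (planeIsometry p - m) ≠ 0)
    (h₁ : quadEigMax ‖c‖ a (planeIsometry p - m) +
          d * ‖quadGrad ‖c‖ a (planeIsometry p - m)‖ ^ τ ≠ 0)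
    (h₂ : quadEigMin ‖c‖ a (planeIsometry p - m) +
          d * ‖quadGrad ‖c‖ a (planeIsometry p - m)‖ ^ τ ≠ 0) :
    newtonDirection (perturbedHessian (costFunction g) τ d p) (∇ (costFunction g) p) =
      planeIsometry.symm (quadDir ‖c‖ a (planeIsometry p - m)
        (d * ‖quadGrad ‖c‖ a (planeIsometry p - m)‖ ^ τ)) := by
  obtain ⟨hK, hq, -⟩ := sub_ne_zero_of_quadGrad h0
  have e₁ : quadEigMax ‖c‖ a (planeIsometry p - m) +
          d * ‖quadGrad ‖c‖ a (planeIsometry p - m)‖ ^ τ =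
      4 * ‖c‖ ^ 2 * ‖planeIsometry p - m‖ ^ 2 +
        d * ‖quadGrad ‖c‖ a (planeIsometry p - m)‖ ^ τ +
        ‖2 * (‖c‖ : ℂ) ^ 2 * ((planeIsometry p - m) ^ 2 - a ^ 2)‖ := by
    rw [norm_two_mul_sq_mul, quadEigMax]; ring
  have e₂ : quadEigMin ‖c‖ a (planeIsometry p - m) +
          d * ‖quadGrad ‖c‖ a (planeIsometry p - m)‖ ^ τ =
      4 * ‖c‖ ^ 2 * ‖planeIsometry p - m‖ ^ 2 +
        d * ‖quadGrad ‖c‖ a (planeIsometry p - m)‖ ^ τ -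
        ‖2 * (‖c‖ : ℂ) ^ 2 * ((planeIsometry p - m) ^ 2 - a ^ 2)‖ := by
    rw [norm_two_mul_sq_mul, quadEigMin]; ring
  rw [quadDir, e₁, e₂]
  rw [e₁] at h₁
  rw [e₂] at h₂
  have hgr : ∇ (costFunction g) p =
      planeIsometry.symm (quadGradMax ‖c‖ a (planeIsometry p - m) +
        quadGradMin ‖c‖ a (planeIsometry p - m)) := by
    rw [← quadGrad_eq_add, gradient_costFunction hg]
  rw [hgr]
  refine newtonDirection_of_conj (perturbedHessian_costFunction hg τ d p)
    (mul_ne_zero (by simpa using hK) hq) h₁ h₂ ?_ ?_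
  · rw [norm_two_mul_sq_mul]; exact mul_conj_quadGradMax _ _ _
  · rw [norm_two_mul_sq_mul]; exact mul_conj_quadGradMin _ _ _

theorem armijo_costFunction_iff (hg : ∀ ζ, g.eval ζ = c * ((ζ - m) ^ 2 - a ^ 2))
    (p : EuclideanSpace ℝ (Fin 2)) (t : ℝ) (d : ℂ) :
    costFunction g (p - t • planeIsometry.symm d) - costFunction g p ≤
        -(t * inner ℝ (planeIsometry.symm d) (∇ (costFunction g) p)) / 3 ↔
      QuadArmijo ‖c‖ a (planeIsometry p - m) (t • d) := by
  rw [QuadArmijo, costFunction_eq hg, costFunction_eq hg, gradient_costFunction hg,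
    LinearIsometryEquiv.inner_map_map, real_inner_smul_left, map_sub, map_smul,
    LinearIsometryEquiv.apply_symm_apply, sub_right_comm]

/-- One iteration of the algorithm at a noncritical point, expressed in the complex plane. -/
structure IsReducedStep (K : ℝ) (a : ℂ) (δ : Fin 3 → ℝ) (θ τ γ₀ : ℝ) (u u' : ℂ) (s t : ℝ) :
    Prop where
  grad_ne : quadGrad K a u ≠ 0
  shift : ∃ j, s = δ j * ‖quadGrad K a u‖ ^ τ
  good : IsGoodShift K a u (bnqnKappa δ) τ s
  step : u' = u - t • quadTrunc K a u θ s
  armijo : QuadArmijo K a u (t • quadTrunc K a u θ s)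
  pos : 0 < t
  le_one : t ≤ 1
  minimal : t = γ₀ ∨ 3 * t ≤ 1 ∧ ¬ QuadArmijo K a u ((3 * t) • quadTrunc K a u θ s)

theorem IsGoodShift.ne_zero {K : ℝ} {u : ℂ} {κ τ s : ℝ} (h : IsGoodShift K a u κ τ s)
    (hκ : 0 < κ) (h0 : quadGrad K a u ≠ 0) :
    quadEigMax K a u + s ≠ 0 ∧ quadEigMin K a u + s ≠ 0 := by
  have : 0 < κ * ‖quadGrad K a u‖ ^ τ := mul_pos hκ (Real.rpow_pos_of_pos (norm_pos_iff.2 h0) _)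
  exact ⟨abs_pos.1 (this.trans_le h.1), abs_pos.1 (this.trans_le h.2)⟩

theorem bnqnKappa_pos_three {δ : Fin 3 → ℝ} (hδ : Function.Injective δ) : 0 < bnqnKappa δ :=
  bnqnKappa_pos hδ (by decide : (0 : Fin 3) ≠ 1)

theorem truncateDirection_symm (θ : ℝ) (w : ℂ) :
    truncateDirection θ (planeIsometry.symm w) =
      planeIsometry.symm ((max 1 (θ * ‖w‖))⁻¹ • w) := by
  rw [truncateDirection, LinearIsometryEquiv.norm_map, map_smul]

theorem gradient_eq_zero_iff (hg : ∀ ζ, g.eval ζ = c * ((ζ - m) ^ 2 - a ^ 2))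
    (p : EuclideanSpace ℝ (Fin 2)) :
    ∇ (costFunction g) p = 0 ↔ quadGrad ‖c‖ a (planeIsometry p - m) = 0 := by
  rw [gradient_costFunction hg]; simp

theorem isGoodShift_iff (hg : ∀ ζ, g.eval ζ = c * ((ζ - m) ^ 2 - a ^ 2)) (κ τ d : ℝ)
    (p : EuclideanSpace ℝ (Fin 2)) (h0 : quadGrad ‖c‖ a (planeIsometry p - m) ≠ 0) :
    κ * ‖∇ (costFunction g) p‖ ^ τ ≤ minsp (perturbedHessian (costFunction g) τ d p) ↔
      IsGoodShift ‖c‖ a (planeIsometry p - m) κ τ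
        (d * ‖quadGrad ‖c‖ a (planeIsometry p - m)‖ ^ τ) := by
  rw [minsp_perturbedHessian hg τ d p h0, le_min_iff, norm_gradient_costFunction hg]
  rfl

theorem IsBNQNStep.eq_of_gradient_eq_zero {δ : Fin 3 → ℝ} {θ τ γ₀ : ℝ} {z z' : EuclideanSpace ℝ (Fin 2)}
    (h : IsBNQNStep (costFunction g) δ θ τ γ₀ z z') (h0 : ∇ (costFunction g) z = 0) :
    z' = z := by
  obtain ⟨j, u, l, -, rfl, -, rfl⟩ := h
  simp [h0, newtonDirection, truncateDirection]

theorem IsBNQNStep.isReducedStep (hg : ∀ ζ, g.eval ζ = c * ((ζ - m) ^ 2 - a ^ 2))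
    {δ : Fin 3 → ℝ} (hδ : Function.Injective δ) {θ τ γ₀ : ℝ} (hγ₀ : 0 < γ₀) (hγ₁ : γ₀ ≤ 1)
    {z z' : EuclideanSpace ℝ (Fin 2)}
    (h : IsBNQNStep (costFunction g) δ θ τ γ₀ z z')
    (h0 : quadGrad ‖c‖ a (planeIsometry z - m) ≠ 0) :
    ∃ s t, IsReducedStep ‖c‖ a δ θ τ γ₀ (planeIsometry z - m) (planeIsometry z' - m) s t := by
  obtain ⟨j, u, l, hj, hu, hl, rfl⟩ := h
  have h0' : ∇ (costFunction g) z ≠ 0 := (gradient_eq_zero_iff hg z).not.2 h0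
  have hgood := (isGoodShift_iff hg _ τ _ z h0).1 (hj.1 h0').1
  obtain ⟨h₁, h₂⟩ := hgood.ne_zero (bnqnKappa_pos_three hδ) h0
  rw [newtonDirection_costFunction hg τ _ z h0 h₁ h₂, truncateDirection_symm] at hu
  obtain ⟨hl₁, hl₂⟩ := hl.1 h0'
  subst hu
  have h3 : (0 : ℝ) < 3 ^ l := by positivity
  refine ⟨δ j * ‖quadGrad ‖c‖ a (planeIsometry z - m)‖ ^ τ, γ₀ / 3 ^ l,
    h0, ⟨j, rfl⟩, hgood, ?_, ?_, by positivity, ?_, ?_⟩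
  · rw [map_sub, map_smul, LinearIsometryEquiv.apply_symm_apply, sub_right_comm]
    rfl
  · exact (armijo_costFunction_iff hg z _ _).1 hl₁
  · rw [div_le_one h3]
    exact hγ₁.trans (one_le_pow₀ (by norm_num))
  -- Either the initial step was accepted, or the preceding trial, three times as long, was
  -- rejected.
  · rcases l with _ | l
    · left; simp
    · right
      have e : 3 * (γ₀ / 3 ^ (l + 1)) = γ₀ / 3 ^ l := by rw [pow_succ]; field_simp
      rw [e]
      refine ⟨?_, fun H => ?_⟩
      · rw [div_le_one (by positivity)]
        exact hγ₁.trans (one_le_pow₀ (by norm_num))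
      · have := hl₂ ((armijo_costFunction_iff hg z _ _).2 H)
        omega

end ReducedStep

/-! ### Norm identities, Taylor expansion of the cost, and the Armijo condition for short steps. -/

section PlaneIdentities

variable {K : ℝ} {a u d : ℂ} {s : ℝ}

/-- Polarization: with q = u² - a², expand |a²|² = |u² - q|². -/
theorem re_mul_conj_sq (a u : ℂ) :
    ((u ^ 2 - a ^ 2) * conj u * conj u).re =
      (‖u ^ 2 - a ^ 2‖ ^ 2 + ‖u‖ ^ 4 - ‖a‖ ^ 4) / 2 := by
  rw [show ‖u‖ ^ 4 = (‖u‖ ^ 2) ^ 2 by ring, show ‖a‖ ^ 4 = (‖a‖ ^ 2) ^ 2 by ring]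
  simp only [← Complex.normSq_eq_norm_sq]
  simp only [Complex.normSq_apply, pow_two, Complex.mul_re,
    Complex.mul_im, Complex.sub_re, Complex.sub_im, Complex.conj_re, Complex.conj_im]
  ring

theorem norm_quadGradMax_sq (K : ℝ) (a u : ℂ) :
    ‖quadGradMax K a u‖ ^ 2 =
      K ^ 4 * ‖u ^ 2 - a ^ 2‖ * ((‖u ^ 2 - a ^ 2‖ + ‖u‖ ^ 2) ^ 2 - ‖a‖ ^ 4) := by
  have h := re_mul_conj_sq a u
  have h1 : ‖(u ^ 2 - a ^ 2) * conj u + ‖u ^ 2 - a ^ 2‖ * u‖ ^ 2 =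
      ‖u ^ 2 - a ^ 2‖ * ((‖u ^ 2 - a ^ 2‖ + ‖u‖ ^ 2) ^ 2 - ‖a‖ ^ 4) := by
    rw [← Complex.normSq_eq_norm_sq, Complex.normSq_add, map_mul, map_mul, map_mul,
      Complex.conj_ofReal, mul_left_comm, Complex.re_ofReal_mul, h, Complex.normSq_conj,
      Complex.normSq_ofReal, Complex.normSq_eq_norm_sq, Complex.normSq_eq_norm_sq]
    ring
  rw [quadGradMax, norm_mul, mul_pow, h1]
  simp only [norm_pow, Complex.norm_real, Real.norm_eq_abs, sq_abs]
  ring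

theorem norm_quadGradMin_sq (K : ℝ) (a u : ℂ) :
    ‖quadGradMin K a u‖ ^ 2 =
      K ^ 4 * ‖u ^ 2 - a ^ 2‖ * (‖a‖ ^ 4 - (‖u ^ 2 - a ^ 2‖ - ‖u‖ ^ 2) ^ 2) := by
  have h := re_mul_conj_sq a u
  have h1 : ‖(u ^ 2 - a ^ 2) * conj u - ‖u ^ 2 - a ^ 2‖ * u‖ ^ 2 =
      ‖u ^ 2 - a ^ 2‖ * (‖a‖ ^ 4 - (‖u ^ 2 - a ^ 2‖ - ‖u‖ ^ 2) ^ 2) := by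
    rw [← Complex.normSq_eq_norm_sq, Complex.normSq_sub, map_mul, map_mul, map_mul,
      Complex.conj_ofReal, mul_left_comm, Complex.re_ofReal_mul, h, Complex.normSq_conj,
      Complex.normSq_ofReal, Complex.normSq_eq_norm_sq, Complex.normSq_eq_norm_sq]
    ring
  rw [quadGradMin, norm_mul, mul_pow, h1]
  simp only [norm_pow, Complex.norm_real, Real.norm_eq_abs, sq_abs]
  ring

theorem inner_quadGradMax_quadGradMin (K : ℝ) (a u : ℂ) :
    inner ℝ (quadGradMax K a u) (quadGradMin K a u) = 0 := by
  have hq := Complex.normSq_apply (u ^ 2 - a ^ 2)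
  rw [Complex.normSq_eq_norm_sq] at hq
  rw [quadGradMax, quadGradMin, ← Complex.ofReal_pow]
  simp only [Complex.inner, map_add, map_mul, Complex.conj_conj, Complex.conj_ofReal,
    Complex.mul_re, Complex.mul_im, Complex.add_re, Complex.add_im, Complex.sub_re, Complex.sub_im,
    Complex.conj_re, Complex.conj_im, Complex.ofReal_re, Complex.ofReal_im] at hq ⊢
  linear_combination (-K ^ 4 * (u.re ^ 2 + u.im ^ 2)) * hq

theorem inner_quadDir_quadGrad (K : ℝ) (a u : ℂ) (s : ℝ) :
    inner ℝ (quadDir K a u s) (quadGrad K a u) =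
      |quadEigMax K a u + s|⁻¹ * ‖quadGradMax K a u‖ ^ 2 +
        |quadEigMin K a u + s|⁻¹ * ‖quadGradMin K a u‖ ^ 2 := by
  have h := inner_quadGradMax_quadGradMin K a u
  have h' := h
  rw [real_inner_comm] at h'
  rw [quadDir, quadGrad_eq_add, inner_add_left, inner_add_right, inner_add_right,
    real_inner_smul_left, real_inner_smul_left, real_inner_smul_left, real_inner_smul_left,
    h, h', real_inner_self_eq_norm_sq, real_inner_self_eq_norm_sq]
  ring

theorem norm_quadGrad_sq (K : ℝ) (a u : ℂ) :
    ‖quadGrad K a u‖ ^ 2 = ‖quadGradMax K a u‖ ^ 2 + ‖quadGradMin K a u‖ ^ 2 := by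
  rw [quadGrad_eq_add, norm_add_sq_real, inner_quadGradMax_quadGradMin]; ring

theorem norm_quadDir_sq (K : ℝ) (a u : ℂ) (s : ℝ) :
    ‖quadDir K a u s‖ ^ 2 =
      |quadEigMax K a u + s|⁻¹ ^ 2 * ‖quadGradMax K a u‖ ^ 2 +
        |quadEigMin K a u + s|⁻¹ ^ 2 * ‖quadGradMin K a u‖ ^ 2 := by
  rw [quadDir, norm_add_sq_real, real_inner_smul_left, real_inner_smul_right,
    inner_quadGradMax_quadGradMin, norm_smul, norm_smul, mul_pow, mul_pow, norm_inv, norm_inv,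
    Real.norm_eq_abs, Real.norm_eq_abs, abs_abs, abs_abs]
  ring

theorem norm_quadGrad (K : ℝ) (a u : ℂ) :
    ‖quadGrad K a u‖ = 2 * K ^ 2 * (‖u ^ 2 - a ^ 2‖ * ‖u‖) := by
  simp [quadGrad]

/-- Exact expansion: replacing u by u - d replaces q = u² - a² by q - d(2u - d). -/
theorem quadCost_sub (K : ℝ) (a u d : ℂ) :
    quadCost K a (u - d) = quadCost K a u - inner ℝ d (quadGrad K a u) +
      K ^ 2 / 2 * (2 * (conj (u ^ 2 - a ^ 2) * d ^ 2).re + ‖d‖ ^ 2 * ‖2 * u - d‖ ^ 2) := by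
  rw [quadCost, quadCost, quadGrad, ← Complex.ofReal_pow]
  simp only [← Complex.normSq_eq_norm_sq]
  simp only [Complex.normSq_apply, pow_two, Complex.mul_re,
    Complex.mul_im, Complex.sub_re, Complex.sub_im, Complex.conj_re, Complex.conj_im,
    Complex.inner, Complex.ofReal_re, Complex.ofReal_im,
    Complex.re_ofNat, Complex.im_ofNat]
  ring

theorem quadCost_sub_le (K : ℝ) (a u d : ℂ) :
    quadCost K a (u - d) ≤ quadCost K a u - inner ℝ d (quadGrad K a u) +
      K ^ 2 / 2 * (‖d‖ ^ 2 * (2 * ‖u ^ 2 - a ^ 2‖ + (2 * ‖u‖ + ‖d‖) ^ 2)) := by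
  rw [quadCost_sub]
  have h1 : (conj (u ^ 2 - a ^ 2) * d ^ 2).re ≤ ‖u ^ 2 - a ^ 2‖ * ‖d‖ ^ 2 := by
    refine (Complex.re_le_norm _).trans_eq ?_
    rw [norm_mul, RCLike.norm_conj, norm_pow]
  have h2 : ‖2 * u - d‖ ≤ 2 * ‖u‖ + ‖d‖ := by
    refine (norm_sub_le _ _).trans_eq ?_
    simp
  have h3 : ‖2 * u - d‖ ^ 2 ≤ (2 * ‖u‖ + ‖d‖) ^ 2 := by gcongr
  have h4 := mul_le_mul_of_nonneg_left h3 (sq_nonneg ‖d‖)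
  have h5 : 2 * (conj (u ^ 2 - a ^ 2) * d ^ 2).re + ‖d‖ ^ 2 * ‖2 * u - d‖ ^ 2 ≤
      ‖d‖ ^ 2 * (2 * ‖u ^ 2 - a ^ 2‖ + (2 * ‖u‖ + ‖d‖) ^ 2) := by linarith
  have := mul_le_mul_of_nonneg_left h5 (by positivity : 0 ≤ K ^ 2 / 2)
  linarith

theorem norm_sq_sub_sq_le (a u : ℂ) : ‖u ^ 2 - a ^ 2‖ ≤ ‖u‖ ^ 2 + ‖a‖ ^ 2 := by
  have := norm_sub_le (u ^ 2) (a ^ 2)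
  rwa [norm_pow u, norm_pow a] at this

theorem norm_sq_le_left (a u : ℂ) : ‖u‖ ^ 2 ≤ ‖u ^ 2 - a ^ 2‖ + ‖a‖ ^ 2 := by
  have := norm_add_le (u ^ 2 - a ^ 2) (a ^ 2)
  rwa [sub_add_cancel, norm_pow u, norm_pow a] at this

theorem norm_sq_le_right (a u : ℂ) : ‖a‖ ^ 2 ≤ ‖u ^ 2 - a ^ 2‖ + ‖u‖ ^ 2 := by
  have := norm_sub_le (u ^ 2) (u ^ 2 - a ^ 2)
  rw [sub_sub_cancel, norm_pow, norm_pow] at this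
  linarith

/-- A bound for the quadratic remainder of `quadCost K a` on a ball of radius `R`, for
displacements of length at most `W`. -/
def armijoConst (K : ℝ) (a : ℂ) (R W : ℝ) : ℝ :=
  K ^ 2 / 2 * (W ^ 2 * (2 * (R ^ 2 + ‖a‖ ^ 2) + (2 * R + W) ^ 2))

theorem armijoConst_nonneg (K : ℝ) (a : ℂ) (R W : ℝ) : 0 ≤ armijoConst K a R W := by
  unfold armijoConst; positivity

/-- For t ≤ 1 the remainder beyond first order is at most t² times `armijoConst`. The Armijo test
asks for only a third of the linear decrease, leaving two thirds to absorb it. -/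
theorem quadArmijo_of_le {R W t : ℝ} {v : ℂ} (hu : ‖u‖ ≤ R) (hv : ‖v‖ ≤ W) (ht : 0 ≤ t)
    (ht1 : t ≤ 1) (h : t * armijoConst K a R W ≤ 2 / 3 * inner ℝ v (quadGrad K a u)) :
    QuadArmijo K a u (t • v) := by
  have hP := norm_sq_sub_sq_le a u
  have h1 := quadCost_sub_le K a u (t • v)
  have hn : ‖t • v‖ = t * ‖v‖ := by rw [norm_smul, Real.norm_of_nonneg ht]
  have h2 : K ^ 2 / 2 * (‖t • v‖ ^ 2 * (2 * ‖u ^ 2 - a ^ 2‖ + (2 * ‖u‖ + ‖t • v‖) ^ 2)) ≤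
      t * (t * armijoConst K a R W) := by
    have h3 : t * ‖v‖ ≤ W := by nlinarith [norm_nonneg v]
    have h4 : 2 * ‖u ^ 2 - a ^ 2‖ + (2 * ‖u‖ + t * ‖v‖) ^ 2 ≤
        2 * (R ^ 2 + ‖a‖ ^ 2) + (2 * R + W) ^ 2 := by
      have : ‖u‖ ^ 2 ≤ R ^ 2 := by gcongr
      gcongr
      linarith
    have h5 : (t * ‖v‖) ^ 2 ≤ (t * W) ^ 2 := by gcongr
    calc _ ≤ K ^ 2 / 2 * ((t * W) ^ 2 * (2 * (R ^ 2 + ‖a‖ ^ 2) + (2 * R + W) ^ 2)) := by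
          rw [hn]; gcongr
      _ = _ := by rw [armijoConst]; ring
  have h3 := mul_le_mul_of_nonneg_left h ht
  rw [QuadArmijo]
  rw [real_inner_smul_left] at h1 ⊢
  linarith

end PlaneIdentities

/-! ### Bounds on the direction and its component along a. -/

section Direction

variable {K : ℝ} {a u : ℂ} {κ τ θ s : ℝ}

theorem norm_quadDir_le {M : ℝ} (hM : 0 ≤ M) (h₁ : |quadEigMax K a u + s|⁻¹ ≤ M)
    (h₂ : |quadEigMin K a u + s|⁻¹ ≤ M) : ‖quadDir K a u s‖ ≤ M * ‖quadGrad K a u‖ := by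
  refine le_of_sq_le_sq ?_ (by positivity)
  rw [norm_quadDir_sq, mul_pow, norm_quadGrad_sq, mul_add]
  gcongr

theorem le_inner_quadDir {M : ℝ} (h₁ : M ≤ |quadEigMax K a u + s|⁻¹)
    (h₂ : M ≤ |quadEigMin K a u + s|⁻¹) :
    M * ‖quadGrad K a u‖ ^ 2 ≤ inner ℝ (quadDir K a u s) (quadGrad K a u) := by
  rw [inner_quadDir_quadGrad, norm_quadGrad_sq, mul_add]
  gcongr

theorem inner_quadDir_pos (h0 : quadGrad K a u ≠ 0) (h₁ : quadEigMax K a u + s ≠ 0)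
    (h₂ : quadEigMin K a u + s ≠ 0) : 0 < inner ℝ (quadDir K a u s) (quadGrad K a u) := by
  have h₁' := inv_pos.2 (abs_pos.2 h₁)
  have h₂' := inv_pos.2 (abs_pos.2 h₂)
  have := norm_pos_iff.2 h0
  exact (by positivity : 0 < min |quadEigMax K a u + s|⁻¹ |quadEigMin K a u + s|⁻¹ *
    ‖quadGrad K a u‖ ^ 2).trans_le (le_inner_quadDir (min_le_left _ _) (min_le_right _ _))

/-- The factor by which the direction is shortened. -/
def truncFactor (θ : ℝ) (w : ℂ) : ℝ := (max 1 (θ * ‖w‖))⁻¹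

theorem truncFactor_pos (θ : ℝ) (w : ℂ) : 0 < truncFactor θ w :=
  inv_pos.2 (zero_lt_one.trans_le (le_max_left _ _))

theorem truncFactor_le_one (θ : ℝ) (w : ℂ) : truncFactor θ w ≤ 1 :=
  inv_le_one_of_one_le₀ (le_max_left _ _)

theorem le_truncFactor (hθ : 0 ≤ θ) {w : ℂ} {W : ℝ} (hw : ‖w‖ ≤ W) :
    (1 + θ * W)⁻¹ ≤ truncFactor θ w := by
  have h1 : θ * ‖w‖ ≤ θ * W := by gcongr
  have h2 : 0 ≤ θ * W := mul_nonneg hθ ((norm_nonneg _).trans hw)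
  refine inv_anti₀ (zero_lt_one.trans_le (le_max_left _ _)) (max_le ?_ ?_) <;> linarith

theorem quadTrunc_eq (K : ℝ) (a u : ℂ) (θ s : ℝ) :
    quadTrunc K a u θ s = truncFactor θ (quadDir K a u s) • quadDir K a u s := rfl

theorem norm_quadTrunc_le (K : ℝ) (a u : ℂ) (θ s : ℝ) :
    ‖quadTrunc K a u θ s‖ ≤ ‖quadDir K a u s‖ := by
  rw [quadTrunc_eq, norm_smul, Real.norm_of_nonneg (truncFactor_pos _ _).le]
  exact mul_le_of_le_one_left (norm_nonneg _) (truncFactor_le_one _ _)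

theorem inner_quadTrunc (K : ℝ) (a u : ℂ) (θ s : ℝ) :
    inner ℝ (quadTrunc K a u θ s) (quadGrad K a u) =
      truncFactor θ (quadDir K a u s) * inner ℝ (quadDir K a u s) (quadGrad K a u) := by
  rw [quadTrunc_eq, real_inner_smul_left]

theorem inner_quadTrunc_pos (h0 : quadGrad K a u ≠ 0) (h₁ : quadEigMax K a u + s ≠ 0)
    (h₂ : quadEigMin K a u + s ≠ 0) : 0 < inner ℝ (quadTrunc K a u θ s) (quadGrad K a u) := by
  rw [inner_quadTrunc]
  exact mul_pos (truncFactor_pos _ _) (inner_quadDir_pos h0 h₁ h₂)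

/-- The factor by which a full step along `quadDir` changes the component along `a`. -/
def quadSlope (K : ℝ) (a u : ℂ) (s : ℝ) : ℝ :=
  K ^ 2 * (|quadEigMax K a u + s|⁻¹ * (‖u ^ 2 - a ^ 2‖ + ‖u‖ ^ 2 - ‖a‖ ^ 2) -
    |quadEigMin K a u + s|⁻¹ * (‖u ^ 2 - a ^ 2‖ + ‖a‖ ^ 2 - ‖u‖ ^ 2))

/-- Both eigencomponents combine u and (u² - a²)·conj u, and the component of the latter along a is
(|u|² - |a|²) times that of u. This proportionality makes the bisector invariant. -/
theorem re_conj_mul_quadDir (K : ℝ) (a u : ℂ) (s : ℝ) :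
    (conj a * quadDir K a u s).re = quadSlope K a u s * (conj a * u).re := by
  have h : (conj a * ((u ^ 2 - a ^ 2) * conj u)).re =
      (‖u‖ ^ 2 - ‖a‖ ^ 2) * (conj a * u).re := by
    simp only [← Complex.normSq_eq_norm_sq]
    simp only [Complex.normSq_apply, pow_two, Complex.mul_re,
      Complex.mul_im, Complex.sub_re, Complex.sub_im, Complex.conj_re, Complex.conj_im]
    ring
  have h₁ : (conj a * quadGradMax K a u).re =
      K ^ 2 * ((‖u ^ 2 - a ^ 2‖ + ‖u‖ ^ 2 - ‖a‖ ^ 2) * (conj a * u).re) := by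
    rw [quadGradMax, mul_left_comm, ← Complex.ofReal_pow, Complex.re_ofReal_mul, mul_add,
      Complex.add_re, h, mul_left_comm, Complex.re_ofReal_mul]
    ring
  have h₂ : (conj a * quadGradMin K a u).re =
      -(K ^ 2 * ((‖u ^ 2 - a ^ 2‖ + ‖a‖ ^ 2 - ‖u‖ ^ 2) * (conj a * u).re)) := by
    rw [quadGradMin, mul_left_comm, ← Complex.ofReal_pow, Complex.re_ofReal_mul, mul_sub,
      Complex.sub_re, h, mul_left_comm, Complex.re_ofReal_mul]
    ring
  rw [quadDir, mul_add, Complex.add_re, mul_smul_comm, mul_smul_comm, Complex.smul_re,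
    Complex.smul_re, h₁, h₂, quadSlope, smul_eq_mul, smul_eq_mul]
  ring

/-- Links the slope to the Armijo decrease. The coefficient of each inverse eigenvalue in the
difference of the two sides factors into terms that are nonnegative by the triangle inequalities
among |u² - a²|, |u|² and |a|². -/
theorem quadSlope_le_inner (K : ℝ) (a u : ℂ) (s : ℝ) :
    2 * K ^ 2 * ‖u ^ 2 - a ^ 2‖ ^ 2 * quadSlope K a u s ≤
      inner ℝ (quadDir K a u s) (quadGrad K a u) := by
  rw [inner_quadDir_quadGrad, norm_quadGradMax_sq, norm_quadGradMin_sq, quadSlope]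
  have e₁ := norm_sq_sub_sq_le a u
  have e₂ := norm_sq_le_left a u
  have e₃ := norm_sq_le_right a u
  set p := |quadEigMax K a u + s|⁻¹
  set p' := |quadEigMin K a u + s|⁻¹
  have hp : 0 ≤ p := by positivity
  have hp' : 0 ≤ p' := by positivity
  set P := ‖u ^ 2 - a ^ 2‖
  have hP : 0 ≤ P := norm_nonneg _
  have h₁ : 0 ≤ K ^ 4 * P * p * ((P + ‖u‖ ^ 2 - ‖a‖ ^ 2) * (‖u‖ ^ 2 + ‖a‖ ^ 2 - P)) :=
    mul_nonneg (by positivity) (mul_nonneg (by linarith) (by linarith))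
  have h₂ : 0 ≤ K ^ 4 * P * p' * ((P + ‖a‖ ^ 2 - ‖u‖ ^ 2) * (‖u‖ ^ 2 + ‖a‖ ^ 2 - P + 2 * P)) :=
    mul_nonneg (by positivity) (mul_nonneg (by linarith) (by linarith))
  linear_combination h₁ + h₂

end Direction

/-! ### Termination of both searches; existence and uniqueness of the sequence. -/

theorem exists_isLeast_of_nonempty {α : Type*} [LinearOrder α] [WellFoundedLT α] {S : Set α}
    (hS : S.Nonempty) : ∃ x, IsLeast S x := by
  obtain ⟨x, hx, h⟩ := (wellFounded_lt (α := α)).has_min S hS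
  exact ⟨x, hx, fun y hy => not_lt.1 (h y hy)⟩

section Existence

variable {c m a : ℂ} {g : ℂ[X]} {δ : Fin 3 → ℝ} {θ τ γ₀ : ℝ}

theorem IsBNQNStep.unique {n : ℕ} {F : EuclideanSpace ℝ (Fin n) → ℝ} {δ : Fin (n + 1) → ℝ}
    {z z₁ z₂ : EuclideanSpace ℝ (Fin n)} (h₁ : IsBNQNStep F δ θ τ γ₀ z z₁)
    (h₂ : IsBNQNStep F δ θ τ γ₀ z z₂) : z₁ = z₂ := by
  obtain ⟨j, u, l, hj, rfl, hl, rfl⟩ := h₁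
  obtain ⟨j', u', l', hj', rfl, hl', rfl⟩ := h₂
  have ej : j = j' := by
    by_cases h0 : ∇ F z = 0
    · rw [hj.2 h0, hj'.2 h0]
    · exact (hj.1 h0).unique (hj'.1 h0)
  subst ej
  have el : l = l' := by
    by_cases h0 : ∇ F z = 0
    · rw [hl.2 h0, hl'.2 h0]
    · exact (hl.1 h0).unique (hl'.1 h0)
  rw [el]

theorem exists_div_pow_mul_le (γ C : ℝ) {b : ℝ} (hγ : 0 < γ) (hC : 0 ≤ C) (hb : 0 < b) :
    ∃ k : ℕ, γ / 3 ^ k * C ≤ b := by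
  obtain ⟨k, hk⟩ := exists_pow_lt_of_lt_one (by positivity : 0 < b / (γ * (C + 1)))
    (by norm_num : (1 / 3 : ℝ) < 1)
  refine ⟨k, ?_⟩
  rw [lt_div_iff₀ (by positivity), one_div, inv_pow] at hk
  have : 0 ≤ (3 ^ k : ℝ)⁻¹ * γ := by positivity
  rw [div_eq_inv_mul]
  nlinarith

theorem exists_isBNQNStep (hg : ∀ ζ, g.eval ζ = c * ((ζ - m) ^ 2 - a ^ 2))
    (hδ : Function.Injective δ) (hγ₀ : 0 < γ₀) (hγ₁ : γ₀ ≤ 1)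
    (z : EuclideanSpace ℝ (Fin 2)) : ∃ z', IsBNQNStep (costFunction g) δ θ τ γ₀ z z' := by
  by_cases h0 : ∇ (costFunction g) z = 0
  · exact ⟨_, 0, _, 0, ⟨fun h => absurd h0 h, fun _ => rfl⟩, rfl,
      ⟨fun h => absurd h0 h, fun _ => rfl⟩, rfl⟩
  have h0' := (gradient_eq_zero_iff hg z).not.1 h0
  obtain ⟨i, hi⟩ := exists_shift (δ := δ) (Real.rpow_pos_of_pos (norm_pos_iff.2 h0') τ)
    (quadEigMax ‖c‖ a (planeIsometry z - m)) (quadEigMin ‖c‖ a (planeIsometry z - m))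
  obtain ⟨j, hj⟩ := exists_isLeast_of_nonempty (S := {i : Fin 3 |
      bnqnKappa δ * ‖∇ (costFunction g) z‖ ^ τ ≤
        minsp (perturbedHessian (costFunction g) τ (δ i) z)})
    ⟨i, (isGoodShift_iff hg _ τ _ z h0').2 hi⟩
  have hgood := (isGoodShift_iff hg _ τ _ z h0').1 hj.1
  obtain ⟨h₁, h₂⟩ := hgood.ne_zero (bnqnKappa_pos_three hδ) h0'
  set s := δ j * ‖quadGrad ‖c‖ a (planeIsometry z - m)‖ ^ τ with hs
  set v := quadTrunc ‖c‖ a (planeIsometry z - m) θ s with hv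
  have hu : truncateDirection θ (newtonDirection (perturbedHessian (costFunction g) τ (δ j) z)
      (∇ (costFunction g) z)) = planeIsometry.symm v := by
    rw [newtonDirection_costFunction hg τ _ z h0' h₁ h₂, truncateDirection_symm]
    rfl
  obtain ⟨k, hk⟩ := exists_div_pow_mul_le γ₀
    (armijoConst ‖c‖ a ‖planeIsometry z - m‖ ‖v‖) hγ₀ (armijoConst_nonneg _ _ _ _)
    (mul_pos (by norm_num : (0 : ℝ) < 2 / 3) (inner_quadTrunc_pos (θ := θ) h0' h₁ h₂))
  have hkA : QuadArmijo ‖c‖ a (planeIsometry z - m) ((γ₀ / 3 ^ k) • v) := by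
    refine quadArmijo_of_le le_rfl le_rfl (by positivity) ?_ hk
    rw [div_le_one (by positivity)]
    exact hγ₁.trans (one_le_pow₀ (by norm_num))
  obtain ⟨l, hl⟩ := exists_isLeast_of_nonempty (S := {k : ℕ |
      costFunction g (z - (γ₀ / 3 ^ k) • planeIsometry.symm v) - costFunction g z ≤
        -((γ₀ / 3 ^ k) * inner ℝ (planeIsometry.symm v) (∇ (costFunction g) z)) / 3})
    ⟨k, (armijo_costFunction_iff hg z _ _).2 hkA⟩
  exact ⟨_, j, planeIsometry.symm v, l, ⟨fun _ => hj, fun h => absurd h h0⟩, hu.symm,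
    ⟨fun _ => hl, fun h => absurd h h0⟩, rfl⟩

theorem existsUnique_isBNQNSequence {n : ℕ} {F : EuclideanSpace ℝ (Fin n) → ℝ}
    {δ : Fin (n + 1) → ℝ} (H : ∀ z, ∃ z', IsBNQNStep F δ θ τ γ₀ z z')
    (z₀ : EuclideanSpace ℝ (Fin n)) : ∃! z, IsBNQNSequence F δ θ τ γ₀ z₀ z := by
  choose f hf using H
  refine ⟨fun k => f^[k] z₀, ⟨rfl, fun k => ?_⟩, fun y hy => ?_⟩
  · show IsBNQNStep F δ θ τ γ₀ (f^[k] z₀) (f^[k + 1] z₀)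
    rw [Function.iterate_succ_apply']
    exact hf _
  · funext k
    induction k with
    | zero => exact hy.1
    | succ k ih =>
      rw [Function.iterate_succ_apply', ← ih]
      exact (hy.2 k).unique (hf _)

end Existence

/-! ### Decrease of the cost and the invariant half-planes. -/

section Descent

variable {K : ℝ} {a u u' : ℂ} {δ : Fin 3 → ℝ} {θ τ γ₀ s t : ℝ}

theorem IsReducedStep.inner_pos (h : IsReducedStep K a δ θ τ γ₀ u u' s t)
    (hδ : Function.Injective δ) : 0 < inner ℝ (quadTrunc K a u θ s) (quadGrad K a u) := by
  obtain ⟨h₁, h₂⟩ := h.good.ne_zero (bnqnKappa_pos_three hδ) h.grad_ne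
  exact inner_quadTrunc_pos h.grad_ne h₁ h₂

theorem IsReducedStep.cost_le (h : IsReducedStep K a δ θ τ γ₀ u u' s t) :
    quadCost K a u' ≤
      quadCost K a u - t * inner ℝ (quadTrunc K a u θ s) (quadGrad K a u) / 3 := by
  have := h.armijo
  rw [QuadArmijo, ← h.step, real_inner_smul_left] at this
  linarith

theorem IsReducedStep.abs_shift_le (h : IsReducedStep K a δ θ τ γ₀ u u' s t) :
    |s| ≤ (∑ j, |δ j|) * ‖quadGrad K a u‖ ^ τ := by
  obtain ⟨j, rfl⟩ := h.shift
  rw [abs_mul, abs_of_nonneg (Real.rpow_nonneg (norm_nonneg _) _)]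
  have := Finset.single_le_sum (f := fun j => |δ j|) (fun i _ => abs_nonneg _)
    (Finset.mem_univ j)
  have h0 := Real.rpow_nonneg (norm_nonneg (quadGrad K a u)) τ
  gcongr

theorem abs_quadEig_le {R : ℝ} (hu : ‖u‖ ≤ R) :
    |quadEigMax K a u| ≤ 2 * K ^ 2 * (2 * R ^ 2 + (R ^ 2 + ‖a‖ ^ 2)) ∧
      |quadEigMin K a u| ≤ 2 * K ^ 2 * (2 * R ^ 2 + (R ^ 2 + ‖a‖ ^ 2)) := by
  have hP := norm_sq_sub_sq_le a u
  have hP0 := norm_nonneg (u ^ 2 - a ^ 2)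
  have hN : ‖u‖ ^ 2 ≤ R ^ 2 := by gcongr
  have hN0 := sq_nonneg ‖u‖
  have hK : 0 ≤ 2 * K ^ 2 := by positivity
  rw [quadEigMax, quadEigMin, abs_mul (2 * K ^ 2), abs_mul (2 * K ^ 2), abs_of_nonneg hK]
  constructor <;> refine mul_le_mul_of_nonneg_left (abs_le.2 ⟨?_, ?_⟩) hK <;> linarith

/-- On a bounded set where the gradient is bounded away from zero, each step decreases the cost by
a definite amount. -/
theorem exists_uniform_decrease (K : ℝ) (a : ℂ) (hδ : Function.Injective δ) (hθ : 0 ≤ θ)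
    (hτ : 0 < τ) (hγ₀ : 0 < γ₀) (R : ℝ) {ε : ℝ} (hε : 0 < ε) :
    ∃ η > 0, ∀ u u' s t, ‖u‖ ≤ R → ε ≤ ‖quadGrad K a u‖ →
      IsReducedStep K a δ θ τ γ₀ u u' s t → quadCost K a u' ≤ quadCost K a u - η := by
  rcases lt_or_ge R 0 with hR | hR
  · exact ⟨1, one_pos, fun u _ _ _ hu => absurd (hu.trans_lt hR) (norm_nonneg u).not_gt⟩
  have hκ := bnqnKappa_pos_three hδ
  set κ := bnqnKappa δ
  -- On the ball, G bounds the gradient, M the shifted eigenvalues, W the direction, and b bounds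
  -- the inner product of truncated direction and gradient from below. The +1 in M and C only
  -- ensures positivity.
  set G := 2 * K ^ 2 * ((R ^ 2 + ‖a‖ ^ 2) * R)
  set D := ∑ j, |δ j|
  have hD : 0 ≤ D := Finset.sum_nonneg fun _ _ => abs_nonneg _
  have hG : 0 ≤ G := by positivity
  have hGτ : 0 ≤ G ^ τ := Real.rpow_nonneg hG _
  have hετ : 0 < ε ^ τ := Real.rpow_pos_of_pos hε _
  set M := 2 * K ^ 2 * (2 * R ^ 2 + (R ^ 2 + ‖a‖ ^ 2)) + D * G ^ τ + 1
  have hM : 0 < M := by positivity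
  set W := (κ * ε ^ τ)⁻¹ * G
  have hW : 0 ≤ W := by positivity
  set b := (1 + θ * W)⁻¹ * (M⁻¹ * ε ^ 2)
  have hb : 0 < b := by positivity
  set C := armijoConst K a R W + 1
  have hC : 0 < C := by have := armijoConst_nonneg K a R W; positivity
  -- A lower bound for the step length, times b, times the Armijo third.
  refine ⟨min γ₀ (2 * b / (9 * C)) * b / 3, by positivity, ?_⟩
  intro u u' s t hu hGε h
  have hGu : ‖quadGrad K a u‖ ≤ G := by
    have hP := norm_sq_sub_sq_le a u
    have hN : ‖u‖ ^ 2 ≤ R ^ 2 := by gcongr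
    rw [norm_quadGrad]
    show _ ≤ 2 * K ^ 2 * ((R ^ 2 + ‖a‖ ^ 2) * R)
    gcongr
    linarith
  have hnτ : ε ^ τ ≤ ‖quadGrad K a u‖ ^ τ := Real.rpow_le_rpow hε.le hGε hτ.le
  have hnτ' : ‖quadGrad K a u‖ ^ τ ≤ G ^ τ := Real.rpow_le_rpow (norm_nonneg _) hGu hτ.le
  have hs : |s| ≤ D * G ^ τ := h.abs_shift_le.trans (by gcongr)
  obtain ⟨e₁, e₂⟩ := abs_quadEig_le (K := K) (a := a) hu
  have hlow : κ * ε ^ τ ≤ κ * ‖quadGrad K a u‖ ^ τ := by gcongr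
  have l₁ := hlow.trans h.good.1
  have l₂ := hlow.trans h.good.2
  have m₁ : |quadEigMax K a u + s| ≤ M := (abs_add_le _ _).trans (by linarith)
  have m₂ : |quadEigMin K a u + s| ≤ M := (abs_add_le _ _).trans (by linarith)
  have hpos : 0 < κ * ε ^ τ := by positivity
  have hw : ‖quadDir K a u s‖ ≤ W :=
    (norm_quadDir_le (by positivity) (inv_anti₀ hpos l₁) (inv_anti₀ hpos l₂)).trans
      (mul_le_mul_of_nonneg_left hGu (by positivity))
  have hin : b ≤ inner ℝ (quadTrunc K a u θ s) (quadGrad K a u) := by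
    rw [inner_quadTrunc]
    have h1 : M⁻¹ * ε ^ 2 ≤ inner ℝ (quadDir K a u s) (quadGrad K a u) :=
      le_trans (by gcongr) (le_inner_quadDir (inv_anti₀ (hpos.trans_le l₁) m₁)
        (inv_anti₀ (hpos.trans_le l₂) m₂))
    have h2 := le_truncFactor hθ hw
    have h3 : 0 ≤ M⁻¹ * ε ^ 2 := by positivity
    exact mul_le_mul h2 h1 h3 (truncFactor_pos _ _).le
  have ht : min γ₀ (2 * b / (9 * C)) ≤ t := by
    rcases h.minimal with rfl | ⟨h3, hna⟩
    · exact min_le_left _ _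
    · refine (min_le_right _ _).trans ?_
      -- If t < 2b/(9C), then 3tC < 2b/3 and the rejected step 3t would have passed the test.
      by_contra! hlt
      apply hna
      refine quadArmijo_of_le hu ((norm_quadTrunc_le _ _ _ _ _).trans hw)
        (by linarith [h.pos]) h3 ?_
      rw [lt_div_iff₀ (by positivity)] at hlt
      have : 3 * t * armijoConst K a R W ≤ 3 * t * C := by
        have := h.pos
        gcongr
        simp [C]
      linarith
  have := h.cost_le
  have h5 : min γ₀ (2 * b / (9 * C)) * b ≤
      t * inner ℝ (quadTrunc K a u θ s) (quadGrad K a u) := by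
    have := h.pos
    gcongr
  linarith

theorem quadCost_nonneg (K : ℝ) (a u : ℂ) : 0 ≤ quadCost K a u := by
  unfold quadCost; positivity

theorem IsReducedStep.re_eq (h : IsReducedStep K a δ θ τ γ₀ u u' s t) :
    (conj a * u').re =
      (1 - t * truncFactor θ (quadDir K a u s) * quadSlope K a u s) * (conj a * u).re := by
  rw [h.step, mul_sub, Complex.sub_re, quadTrunc_eq, mul_smul_comm, mul_smul_comm,
    Complex.smul_re, Complex.smul_re, re_conj_mul_quadDir, smul_eq_mul, smul_eq_mul]
  ring

/-- No step can cross the bisector. Since the cost stays nonnegative, the Armijo decrease is at most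
the current cost; with `quadSlope_le_inner` this bounds the product by 3/4. -/
theorem IsReducedStep.slope_lt (h : IsReducedStep K a δ θ τ γ₀ u u' s t) :
    t * truncFactor θ (quadDir K a u s) * quadSlope K a u s < 1 := by
  obtain ⟨hK, hq, -⟩ := sub_ne_zero_of_quadGrad h.grad_ne
  have h1 := h.cost_le
  have h2 := quadCost_nonneg K a u'
  have h3 := quadSlope_le_inner K a u s
  rw [inner_quadTrunc] at h1
  have hT : 0 < t * truncFactor θ (quadDir K a u s) := mul_pos h.pos (truncFactor_pos _ _)
  have h4 := mul_le_mul_of_nonneg_left h3 hT.le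
  have hP := norm_pos_iff.2 hq
  have hE : 0 < K ^ 2 * ‖u ^ 2 - a ^ 2‖ ^ 2 := by positivity
  have hc : quadCost K a u = K ^ 2 * ‖u ^ 2 - a ^ 2‖ ^ 2 / 2 := rfl
  rw [hc] at h1
  by_contra! hge
  nlinarith

/-- A sequence in the complex plane in normal form produced by the algorithm. -/
def IsReducedOrbit (K : ℝ) (a : ℂ) (δ : Fin 3 → ℝ) (θ τ γ₀ : ℝ) (u : ℕ → ℂ) : Prop :=
  ∀ n, (quadGrad K a (u n) = 0 ∧ u (n + 1) = u n) ∨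
    ∃ s t, IsReducedStep K a δ θ τ γ₀ (u n) (u (n + 1)) s t

/-! ### Limits of orbits. -/

variable {u : ℕ → ℂ}

theorem IsReducedOrbit.antitone (h : IsReducedOrbit K a δ θ τ γ₀ u)
    (hδ : Function.Injective δ) : Antitone fun n => quadCost K a (u n) := by
  refine antitone_nat_of_succ_le fun n => ?_
  rcases h n with ⟨-, h⟩ | ⟨s, t, h⟩
  · rw [h]
  · have := h.cost_le
    have := mul_pos h.pos (h.inner_pos hδ)
    linarith

theorem IsReducedOrbit.exists_tendsto (h : IsReducedOrbit K a δ θ τ γ₀ u)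
    (hδ : Function.Injective δ) :
    ∃ l, Tendsto (fun n => quadCost K a (u n)) atTop (𝓝 l) :=
  ⟨_, tendsto_atTop_ciInf (h.antitone hδ) ⟨0, by
    rintro _ ⟨n, rfl⟩; exact quadCost_nonneg _ _ _⟩⟩

theorem IsReducedOrbit.exists_norm_le (h : IsReducedOrbit K a δ θ τ γ₀ u)
    (hδ : Function.Injective δ) (hK : K ≠ 0) : ∃ R, ∀ n, ‖u n‖ ≤ R := by
  -- Descent gives ‖u n‖² ≤ B for B = ‖u 0 ^ 2 - a ^ 2‖ + ‖a‖²; then ‖u n‖ ≤ B + 1, without taking a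
  -- square root.
  refine ⟨‖u 0 ^ 2 - a ^ 2‖ + ‖a‖ ^ 2 + 1, fun n => ?_⟩
  have h1 : quadCost K a (u n) ≤ quadCost K a (u 0) := h.antitone hδ (Nat.zero_le n)
  have hK2 : 0 < K ^ 2 := by positivity
  rw [quadCost, quadCost] at h1
  have h2 : ‖u n ^ 2 - a ^ 2‖ ≤ ‖u 0 ^ 2 - a ^ 2‖ := by
    refine le_of_sq_le_sq ?_ (norm_nonneg _)
    nlinarith
  have h3 := norm_sq_le_left a (u n)
  nlinarith [sq_nonneg (‖u n‖ - 1), norm_nonneg (u n)]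

/-- The cost converges, so its successive decreases tend to 0 and are eventually smaller than the
uniform decrease forced by a gradient of norm at least ε. -/
theorem IsReducedOrbit.tendsto_grad (h : IsReducedOrbit K a δ θ τ γ₀ u)
    (hδ : Function.Injective δ) (hK : K ≠ 0) (hθ : 0 ≤ θ) (hτ : 0 < τ) (hγ₀ : 0 < γ₀) :
    Tendsto (fun n => ‖quadGrad K a (u n)‖) atTop (𝓝 0) := by
  obtain ⟨R, hR⟩ := h.exists_norm_le hδ hK
  obtain ⟨l, hl⟩ := h.exists_tendsto hδ
  have hd : Tendsto (fun n => quadCost K a (u n) - quadCost K a (u (n + 1))) atTop (𝓝 0) := by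
    simpa using hl.sub (hl.comp (tendsto_add_atTop_nat 1))
  rw [Metric.tendsto_nhds]
  intro ε hε
  obtain ⟨η, hη, H⟩ := exists_uniform_decrease K a hδ hθ hτ hγ₀ R hε
  filter_upwards [hd.eventually (gt_mem_nhds hη)] with n hn
  rw [dist_zero_right, norm_norm]
  rcases h n with ⟨h0, -⟩ | ⟨s, t, hs⟩
  · rwa [h0, norm_zero]
  · by_contra! hge
    have := H _ _ _ _ (hR n) hge hs
    linarith

theorem IsReducedOrbit.tendsto_mul (h : IsReducedOrbit K a δ θ τ γ₀ u)
    (hδ : Function.Injective δ) (hK : K ≠ 0) (hθ : 0 ≤ θ) (hτ : 0 < τ) (hγ₀ : 0 < γ₀) :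
    Tendsto (fun n => ‖u n ^ 2 - a ^ 2‖ * ‖u n‖) atTop (𝓝 0) := by
  have := (h.tendsto_grad hδ hK hθ hτ hγ₀).const_mul (2 * K ^ 2)⁻¹
  rw [mul_zero] at this
  refine this.congr fun n => ?_
  rw [norm_quadGrad]
  field_simp

theorem tendsto_zero_of_mul {f k : ℕ → ℝ} {b : ℝ} (hb : 0 < b) (hf : ∀ᶠ n in atTop, b ≤ f n)
    (hk : ∀ n, 0 ≤ k n) (h : Tendsto (fun n => f n * k n) atTop (𝓝 0)) :
    Tendsto k atTop (𝓝 0) := by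
  have h' := h.const_mul b⁻¹
  rw [mul_zero] at h'
  refine squeeze_zero' (Eventually.of_forall hk) ?_ h'
  filter_upwards [hf] with n hn
  rw [inv_mul_eq_div, le_div_iff₀ hb, mul_comm]
  exact mul_le_mul_of_nonneg_right hn (hk n)

theorem IsReducedOrbit.tendsto_zero_of_eq_zero (h : IsReducedOrbit K 0 δ θ τ γ₀ u)
    (hδ : Function.Injective δ) (hK : K ≠ 0) (hθ : 0 ≤ θ) (hτ : 0 < τ) (hγ₀ : 0 < γ₀) :
    Tendsto u atTop (𝓝 0) := by
  have h1 := h.tendsto_mul hδ hK hθ hτ hγ₀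
  rw [tendsto_zero_iff_norm_tendsto_zero]
  have h2 : Tendsto (fun n => ‖u n‖ ^ 3) atTop (𝓝 0) := by
    refine h1.congr fun n => ?_
    simp
    ring
  have h3 := h2.rpow_const (p := (1 / 3 : ℝ)) (Or.inr (by norm_num))
  rw [Real.zero_rpow (by norm_num)] at h3
  refine h3.congr fun n => ?_
  have := Real.pow_rpow_inv_natCast (norm_nonneg (u n)) (n := 3) (by norm_num)
  simpa using this

theorem IsReducedOrbit.re_eq_zero (h : IsReducedOrbit K a δ θ τ γ₀ u)
    (h0 : (conj a * u 0).re = 0) (n : ℕ) : (conj a * u n).re = 0 := by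
  induction n with
  | zero => exact h0
  | succ n ih =>
    rcases h n with ⟨-, e⟩ | ⟨s, t, e⟩
    · rw [e, ih]
    · rw [e.re_eq, ih, mul_zero]

theorem IsReducedOrbit.re_pos (h : IsReducedOrbit K a δ θ τ γ₀ u)
    (h0 : 0 < (conj a * u 0).re) (n : ℕ) : 0 < (conj a * u n).re := by
  induction n with
  | zero => exact h0
  | succ n ih =>
    rcases h n with ⟨-, e⟩ | ⟨s, t, e⟩
    · rwa [e]
    · rw [e.re_eq]
      exact mul_pos (by linarith [e.slope_lt]) ih

theorem norm_le_of_re_conj_mul {a w : ℂ} (ha : a ≠ 0) (h : ‖a‖ ^ 2 ≤ (conj a * w).re) :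
    ‖a‖ ≤ ‖w‖ := by
  have h1 := h.trans (Complex.re_le_norm _)
  rw [norm_mul, RCLike.norm_conj, pow_two] at h1
  exact le_of_mul_le_mul_left h1 (norm_pos_iff.2 ha)

/-- The orbit stays on the bisector, at distance at least |a| from both roots, so in |u² - a²||u| →
0 it is |u| that must vanish. -/
theorem IsReducedOrbit.tendsto_zero_of_re_eq_zero (h : IsReducedOrbit K a δ θ τ γ₀ u)
    (hδ : Function.Injective δ) (hK : K ≠ 0) (hθ : 0 ≤ θ) (hτ : 0 < τ) (hγ₀ : 0 < γ₀)
    (ha : a ≠ 0) (h0 : (conj a * u 0).re = 0) : Tendsto u atTop (𝓝 0) := by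
  have h1 := h.tendsto_mul hδ hK hθ hτ hγ₀
  have ha' := norm_pos_iff.2 ha
  rw [tendsto_zero_iff_norm_tendsto_zero]
  refine tendsto_zero_of_mul (b := ‖a‖ ^ 2) (by positivity) (Eventually.of_forall fun n => ?_)
    (fun n => norm_nonneg _) h1
  have hn := h.re_eq_zero h0 n
  have haa : (conj a * a).re = ‖a‖ ^ 2 := by
    rw [← Complex.normSq_eq_conj_mul_self, Complex.ofReal_re, Complex.normSq_eq_norm_sq]
  have e₁ : ‖a‖ ≤ ‖u n + a‖ := by
    refine norm_le_of_re_conj_mul ha ?_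
    rw [mul_add, Complex.add_re, hn, haa, zero_add]
  have e₂ : ‖a‖ ≤ ‖u n - a‖ := by
    rw [norm_sub_rev]
    refine norm_le_of_re_conj_mul ha ?_
    rw [mul_sub, Complex.sub_re, hn, haa, sub_zero]
  rw [sq_sub_sq, norm_mul, pow_two]
  gcongr

theorem quadSlope_nonpos_of_le {u : ℂ} (h₁ : quadEigMax K a u + s ≠ 0)
    (h₂ : quadEigMin K a u + s ≠ 0)
    (h : |quadEigMin K a u + s| * (‖u ^ 2 - a ^ 2‖ + ‖u‖ ^ 2 - ‖a‖ ^ 2) ≤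
      |quadEigMax K a u + s| * (‖u ^ 2 - a ^ 2‖ + ‖a‖ ^ 2 - ‖u‖ ^ 2)) :
    quadSlope K a u s ≤ 0 := by
  have h₁' := abs_pos.2 h₁
  have h₂' := abs_pos.2 h₂
  refine mul_nonpos_of_nonneg_of_nonpos (by positivity) ?_
  rw [sub_nonpos, inv_mul_le_iff₀ h₁', mul_left_comm, le_inv_mul_iff₀ h₂']
  exact h

/-- Off the perpendicular bisector an orbit cannot converge to the midpoint. -/
theorem IsReducedOrbit.not_tendsto_zero (h : IsReducedOrbit K a δ θ τ γ₀ u)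
    (hδ : Function.Injective δ) (hK : K ≠ 0) (hτ : 0 < τ)
    (ha : a ≠ 0) (h0 : 0 < (conj a * u 0).re) : ¬ Tendsto u atTop (𝓝 0) := by
  intro hu
  have ha' := norm_pos_iff.2 ha
  have hN : Tendsto (fun n => ‖u n‖) atTop (𝓝 0) := by simpa using hu.norm
  have hP : Tendsto (fun n => ‖u n ^ 2 - a ^ 2‖) atTop (𝓝 (‖a‖ ^ 2)) := by
    have := ((hu.pow 2).sub_const (a ^ 2)).norm
    rwa [zero_pow two_ne_zero, zero_sub, norm_neg, norm_pow] at this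
  have hG : Tendsto (fun n => ‖quadGrad K a (u n)‖) atTop (𝓝 0) := by
    have := (hP.mul hN).const_mul (2 * K ^ 2)
    rw [mul_zero, mul_zero] at this
    exact this.congr fun n => (norm_quadGrad _ _ _).symm
  -- The shifts used along the orbit, set to 0 at stationary steps, vanish in the limit because τ >
  -- 0.
  have hσ : ∃ σ : ℕ → ℝ, Tendsto σ atTop (𝓝 0) ∧ ∀ n, u (n + 1) = u n ∨
      ∃ t, IsReducedStep K a δ θ τ γ₀ (u n) (u (n + 1)) (σ n) t := by
    have : ∀ n, ∃ s, |s| ≤ (∑ j, |δ j|) * ‖quadGrad K a (u n)‖ ^ τ ∧ (u (n + 1) = u n ∨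
        ∃ t, IsReducedStep K a δ θ τ γ₀ (u n) (u (n + 1)) s t) := by
      intro n
      rcases h n with ⟨-, e⟩ | ⟨s, t, e⟩
      · refine ⟨0, ?_, Or.inl e⟩
        rw [abs_zero]
        exact mul_nonneg (Finset.sum_nonneg fun _ _ => abs_nonneg _)
          (Real.rpow_nonneg (norm_nonneg _) _)
      · exact ⟨s, e.abs_shift_le, Or.inr ⟨t, e⟩⟩
    choose σ hσ hσ' using this
    refine ⟨σ, ?_, hσ'⟩
    have hb := (hG.rpow_const (p := τ) (Or.inr hτ.le)).const_mul (∑ j, |δ j|)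
    rw [Real.zero_rpow hτ.ne', mul_zero] at hb
    exact squeeze_zero_norm hσ hb
  obtain ⟨σ, hσ, hstep⟩ := hσ
  have hmax : Tendsto (fun n => |quadEigMax K a (u n) + σ n|) atTop
      (𝓝 (2 * K ^ 2 * ‖a‖ ^ 2)) := by
    have := (((((hN.pow 2).const_mul 2).add hP).const_mul (2 * K ^ 2)).add hσ).abs
    simp only [zero_pow two_ne_zero, mul_zero, zero_add, add_zero] at this
    rwa [abs_of_nonneg (by positivity)] at this
  have hmin : Tendsto (fun n => |quadEigMin K a (u n) + σ n|) atTop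
      (𝓝 (2 * K ^ 2 * ‖a‖ ^ 2)) := by
    have := (((((hN.pow 2).const_mul 2).sub hP).const_mul (2 * K ^ 2)).add hσ).abs
    simp only [zero_pow two_ne_zero, mul_zero, zero_sub, add_zero, mul_neg, abs_neg] at this
    rwa [abs_of_nonneg (by positivity)] at this
  -- The midpoint is a saddle with eigenvalues ±2K²|a|², equal in absolute value. The difference
  -- tends to 4K²|a|⁴ > 0, so the slope is eventually nonpositive and the component along a cannot
  -- decrease.
  have hdiff := (hmax.mul ((hP.add_const (‖a‖ ^ 2)).sub (hN.pow 2))).sub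
    (hmin.mul ((hP.add (hN.pow 2)).sub_const (‖a‖ ^ 2)))
  have hpos : 0 < 2 * K ^ 2 * ‖a‖ ^ 2 * (‖a‖ ^ 2 + ‖a‖ ^ 2 - 0 ^ 2) -
      2 * K ^ 2 * ‖a‖ ^ 2 * (‖a‖ ^ 2 + 0 ^ 2 - ‖a‖ ^ 2) := by
    have : 0 < 4 * K ^ 2 * ‖a‖ ^ 4 := by positivity
    linarith
  obtain ⟨n₀, hn₀⟩ := eventually_atTop.1 (hdiff.eventually (lt_mem_nhds hpos))
  have hmono : ∀ n ≥ n₀, (conj a * u n₀).re ≤ (conj a * u n).re := by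
    intro n hn
    induction n, hn using Nat.le_induction with
    | base => exact le_rfl
    | succ n hn ih =>
      refine ih.trans ?_
      rcases hstep n with e | ⟨t, e⟩
      · rw [e]
      · obtain ⟨h₁, h₂⟩ := e.good.ne_zero (bnqnKappa_pos_three hδ) e.grad_ne
        have hS := quadSlope_nonpos_of_le h₁ h₂ (sub_pos.1 (hn₀ n hn)).le
        have hT : 0 < t * truncFactor θ (quadDir K a (u n) (σ n)) :=
          mul_pos e.pos (truncFactor_pos _ _)
        have hX := h.re_pos h0 n
        rw [e.re_eq]
        nlinarith [mul_nonneg hT.le (neg_nonneg.2 hS)]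
  have hre : Tendsto (fun n => (conj a * u n).re) atTop (𝓝 0) := by
    have := (Complex.continuous_re.tendsto _).comp (hu.const_mul (conj a))
    rwa [mul_zero, Complex.zero_re] at this
  have := ge_of_tendsto hre (eventually_atTop.2 ⟨n₀, hmono⟩)
  exact absurd (h.re_pos h0 n₀) this.not_gt

theorem IsReducedOrbit.tendsto_of_re_pos (h : IsReducedOrbit K a δ θ τ γ₀ u)
    (hδ : Function.Injective δ) (hK : K ≠ 0) (hθ : 0 ≤ θ) (hτ : 0 < τ) (hγ₀ : 0 < γ₀)
    (ha : a ≠ 0) (h0 : 0 < (conj a * u 0).re) : Tendsto u atTop (𝓝 a) := by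
  have h1 := h.tendsto_mul hδ hK hθ hτ hγ₀
  have ha' := norm_pos_iff.2 ha
  obtain ⟨l, hl⟩ := h.exists_tendsto hδ
  have hP : Tendsto (fun n => ‖u n ^ 2 - a ^ 2‖) atTop (𝓝 (√(2 / K ^ 2 * l))) := by
    have := (hl.const_mul (2 / K ^ 2)).sqrt
    refine this.congr fun n => ?_
    rw [quadCost, show 2 / K ^ 2 * (K ^ 2 * ‖u n ^ 2 - a ^ 2‖ ^ 2 / 2) = ‖u n ^ 2 - a ^ 2‖ ^ 2 by
      field_simp, Real.sqrt_sq (norm_nonneg _)]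
  -- A zero limit of |u² - a²| leads to the root a; a positive one would force u → 0, already
  -- excluded.
  rcases (Real.sqrt_nonneg (2 / K ^ 2 * l)).eq_or_lt with e | e
  · rw [← e] at hP
    rw [tendsto_iff_norm_sub_tendsto_zero]
    refine tendsto_zero_of_mul (f := fun n => ‖u n + a‖) ha' (Eventually.of_forall fun n => ?_)
      (fun n => norm_nonneg _) (hP.congr fun n => ?_)
    · refine norm_le_of_re_conj_mul ha ?_
      have haa : (conj a * a).re = ‖a‖ ^ 2 := by
        rw [← Complex.normSq_eq_conj_mul_self, Complex.ofReal_re, Complex.normSq_eq_norm_sq]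
      rw [mul_add, Complex.add_re, haa]
      linarith [h.re_pos h0 n]
    · rw [sq_sub_sq, norm_mul]
  · refine absurd ?_ (h.not_tendsto_zero hδ hK hτ ha h0)
    rw [tendsto_zero_iff_norm_tendsto_zero]
    refine tendsto_zero_of_mul (half_pos e) ?_ (fun n => norm_nonneg _) h1
    filter_upwards [hP.eventually (lt_mem_nhds (half_lt_self e))] with n hn using hn.le

end Descent

/-! ### Completing the square, and the bisector in normal coordinates. -/

section NormalForm

variable {c m a : ℂ} {g : ℂ[X]} {δ : Fin 3 → ℝ} {θ τ γ₀ : ℝ}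

theorem IsBNQNSequence.isReducedOrbit (hg : ∀ ζ, g.eval ζ = c * ((ζ - m) ^ 2 - a ^ 2))
    (hδ : Function.Injective δ) (hγ₀ : 0 < γ₀) (hγ₁ : γ₀ ≤ 1) {z₀ : EuclideanSpace ℝ (Fin 2)}
    {z : ℕ → EuclideanSpace ℝ (Fin 2)}
    (h : IsBNQNSequence (costFunction g) δ θ τ γ₀ z₀ z) :
    IsReducedOrbit ‖c‖ a δ θ τ γ₀ fun n => toComplex (z n) - m := by
  intro n
  simp only [← planeIsometry_apply]
  by_cases h0 : quadGrad ‖c‖ a (planeIsometry (z n) - m) = 0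
  · left
    refine ⟨h0, ?_⟩
    rw [(h.2 n).eq_of_gradient_eq_zero ((gradient_eq_zero_iff hg _).2 h0)]
  · exact Or.inr ((h.2 n).isReducedStep hg hδ hγ₀ hγ₁ h0)

theorem exists_normalForm (hg : g.natDegree = 2) :
    ∃ c m a : ℂ, ∀ ζ, g.eval ζ = c * ((ζ - m) ^ 2 - a ^ 2) := by
  have hc : g.coeff 2 ≠ 0 := by
    rw [← hg]
    exact leadingCoeff_ne_zero.2 (by rintro rfl; simp at hg)
  obtain ⟨a, ha⟩ := IsAlgClosed.exists_pow_nat_eq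
    ((g.coeff 1 / (2 * g.coeff 2)) ^ 2 - g.coeff 0 / g.coeff 2) (n := 2) (by norm_num)
  refine ⟨g.coeff 2, -(g.coeff 1 / (2 * g.coeff 2)), a, fun ζ => ?_⟩
  rw [ha, eval_eq_sum_range, hg]
  simp only [Finset.sum_range_succ, Finset.range_zero, Finset.sum_empty]
  field_simp
  ring

theorem re_eq_zero_of_mem_perpBisector {z₁ z₂ w : ℂ}
    (hw : w ∈ AffineSubspace.perpBisector z₁ z₂) :
    (conj ((z₁ - z₂) / 2) * (w - (z₁ + z₂) / 2)).re = 0 := by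
  rw [AffineSubspace.mem_perpBisector_iff_inner_eq_zero, midpoint_eq_smul_add] at hw
  have h2 : (z₁ - z₂) / 2 = (1 / 2 : ℝ) • (z₁ - z₂) := by
    rw [Complex.real_smul]; push_cast; ring
  rw [h2]
  simp [Complex.inner] at hw ⊢
  linear_combination (-1 / 2) * hw

/-- Points strictly on the same side of the perpendicular bisector as `z₁`. -/
theorem re_pos_of_sSameSide {z₁ z₂ w : ℂ} (h : z₁ ≠ z₂)
    (hw : (AffineSubspace.perpBisector z₁ z₂).SSameSide z₁ w) :
    0 < (conj ((z₁ - z₂) / 2) * (w - (z₁ + z₂) / 2)).re := by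
  obtain ⟨⟨p, hp, q, hq, hr⟩, h₁, h₂⟩ := hw
  have hp' := re_eq_zero_of_mem_perpBisector hp
  have hq' := re_eq_zero_of_mem_perpBisector hq
  have ha : 0 < (conj ((z₁ - z₂) / 2) * (z₁ - (z₁ + z₂) / 2)).re := by
    have : z₁ - (z₁ + z₂) / 2 = (z₁ - z₂) / 2 := by ring
    rw [this, ← Complex.normSq_eq_conj_mul_self, Complex.ofReal_re, Complex.normSq_pos]
    exact div_ne_zero (sub_ne_zero.2 h) two_ne_zero
  -- The two degenerate cases of `SameRay` would put z₁ or w on the bisector.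
  rcases hr with hr | hr | ⟨r₁, r₂, hr₁, hr₂, hr⟩
  · rw [vsub_eq_sub, sub_eq_zero] at hr
    exact absurd (hr ▸ hp) h₁
  · rw [vsub_eq_sub, sub_eq_zero] at hr
    exact absurd (hr ▸ hq) h₂
  · have e := congrArg (fun x => (conj ((z₁ - z₂) / 2) * x).re) hr
    simp only [vsub_eq_sub, mul_smul_comm, Complex.smul_re, smul_eq_mul] at e
    rw [← sub_sub_sub_cancel_right z₁ p ((z₁ + z₂) / 2),
      ← sub_sub_sub_cancel_right w q ((z₁ + z₂) / 2), mul_sub, mul_sub _ (w - _), Complex.sub_re,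
      Complex.sub_re, hp', hq', sub_zero, sub_zero] at e
    exact (mul_pos_iff_of_pos_left hr₂).1 (e ▸ mul_pos hr₁ ha)

end NormalForm

end

theorem theorem1 (g : ℂ[X]) (hg : g.natDegree = 2)
    (δ : Fin 3 → ℝ) (hδ : Function.Injective δ)
    (θ : ℝ) (hθ : 0 ≤ θ) (τ : ℝ) (hτ : 0 < τ) (γ₀ : ℝ) (hγ₀ : 0 < γ₀) (hγ₀' : γ₀ ≤ 1) :
    -- the algorithm never gets stuck: it constructs exactly one sequence from each initial point
    (∀ z₀ : EuclideanSpace ℝ (Fin 2),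
      ∃! z : ℕ → EuclideanSpace ℝ (Fin 2), IsBNQNSequence (costFunction g) δ θ τ γ₀ z₀ z) ∧
    -- a double root
    (∀ c zs : ℂ, g = C c * (X - C zs) ^ 2 →
      ∀ (z₀ : EuclideanSpace ℝ (Fin 2)) (z : ℕ → EuclideanSpace ℝ (Fin 2)),
        IsBNQNSequence (costFunction g) δ θ τ γ₀ z₀ z →
          Tendsto (fun n => toComplex (z n)) atTop (𝓝 zs)) ∧
    -- distinct roots
    (∀ c z₁ z₂ : ℂ, z₁ ≠ z₂ → g = C c * (X - C z₁) * (X - C z₂) →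
      (∀ (z₀ : EuclideanSpace ℝ (Fin 2)) (z : ℕ → EuclideanSpace ℝ (Fin 2)),
        IsBNQNSequence (costFunction g) δ θ τ γ₀ z₀ z →
          ((AffineSubspace.perpBisector z₁ z₂).SSameSide z₁ (toComplex z₀) →
            Tendsto (fun n => toComplex (z n)) atTop (𝓝 z₁)) ∧
          ((AffineSubspace.perpBisector z₁ z₂).SSameSide z₂ (toComplex z₀) →
            Tendsto (fun n => toComplex (z n)) atTop (𝓝 z₂)) ∧
          (toComplex z₀ ∈ AffineSubspace.perpBisector z₁ z₂ →
            Tendsto (fun n => toComplex (z n)) atTop (𝓝 ((z₁ + z₂) / 2)))) ∧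
      g.derivative.eval ((z₁ + z₂) / 2) = 0) := by
  refine ⟨?_, ?_, ?_⟩
  · obtain ⟨c, m, a, h⟩ := exists_normalForm hg
    exact existsUnique_isBNQNSequence (exists_isBNQNStep h hδ hγ₀ hγ₀')
  · intro c zs hgc z₀ z hz
    have hc : ‖c‖ ≠ 0 := by
      rw [norm_ne_zero_iff]
      rintro rfl
      simp [hgc] at hg
    have h : ∀ ζ, g.eval ζ = c * ((ζ - zs) ^ 2 - 0 ^ 2) := fun ζ => by simp [hgc]
    have := (hz.isReducedOrbit h hδ hγ₀ hγ₀').tendsto_zero_of_eq_zero hδ hc hθ hτ hγ₀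
    simpa using this.add_const zs
  · intro c z₁ z₂ hne hgc
    have hc : ‖c‖ ≠ 0 := by
      rw [norm_ne_zero_iff]
      rintro rfl
      simp [hgc] at hg
    -- Stated for arbitrary z₁, z₂ so that it can be applied again with the roots exchanged, which
    -- replaces a by -a.
    have main : ∀ z₁ z₂ : ℂ, z₁ ≠ z₂ → g = C c * (X - C z₁) * (X - C z₂) →
        ∀ (z₀ : EuclideanSpace ℝ (Fin 2)) (z : ℕ → EuclideanSpace ℝ (Fin 2)),
        IsBNQNSequence (costFunction g) δ θ τ γ₀ z₀ z →
          ((AffineSubspace.perpBisector z₁ z₂).SSameSide z₁ (toComplex z₀) →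
            Tendsto (fun n => toComplex (z n)) atTop (𝓝 z₁)) ∧
          (toComplex z₀ ∈ AffineSubspace.perpBisector z₁ z₂ →
            Tendsto (fun n => toComplex (z n)) atTop (𝓝 ((z₁ + z₂) / 2))) := by
      intro z₁ z₂ hne hgc z₀ z hz
      have h : ∀ ζ, g.eval ζ = c * ((ζ - (z₁ + z₂) / 2) ^ 2 - ((z₁ - z₂) / 2) ^ 2) := fun ζ => by
        simp [hgc]
        ring
      have ha : (z₁ - z₂) / 2 ≠ 0 := div_ne_zero (sub_ne_zero.2 hne) two_ne_zero
      have horb := hz.isReducedOrbit h hδ hγ₀ hγ₀'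
      constructor
      · intro hs
        have := (horb.tendsto_of_re_pos hδ hc hθ hτ hγ₀ ha (by
          simp only [hz.1]
          exact re_pos_of_sSameSide hne hs)).add_const ((z₁ + z₂) / 2)
        simp only [sub_add_cancel] at this
        convert this using 2
        ring
      · intro hs
        have := (horb.tendsto_zero_of_re_eq_zero hδ hc hθ hτ hγ₀ ha (by
          simp only [hz.1]
          exact re_eq_zero_of_mem_perpBisector hs)).add_const ((z₁ + z₂) / 2)
        simpa using this
    refine ⟨fun z₀ z hz => ⟨(main z₁ z₂ hne hgc z₀ z hz).1, ?_, (main z₁ z₂ hne hgc z₀ z hz).2⟩, ?_⟩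
    · rw [AffineSubspace.perpBisector_comm]
      exact (main z₂ z₁ hne.symm (by rw [hgc]; ring) z₀ z hz).1
    · rw [hgc]
      simp [derivative_mul]
      ring
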